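/- Let $R$ be a commutative artinian ring and $k\ge 0$ an integer (for the case of interest, $k\ge 1$). A $k$-sequence is a function $u:\mathbb N_0^k\to R$, a $k$-bisequence a function $w:\mathbb Z^k\to R$. The polynomial ring $R[\mathbf x]=R[x_1,\dots,x_k]$ acts on both by $\big((\sum_{\mathbf i} a_{\mathbf i}\mathbf x^{\mathbf i})\rightharpoonup w\big)(\mathbf n)=\sum_{\mathbf i} a_{\mathbf i}\,w(\mathbf n+\mathbf i)$; let $\mathrm{An}(w)\subseteq R[\mathbf x]$ be the annihilator of $w$. A one-variable polynomial $q$ is reversible if it is monic and $q(0)$ is a unit of $R$. A $k$-sequence or $k$-bisequence is linearly recursive (resp. linearly birecursive) if its annihilator contains, for every $j$, a polynomial $f_j(x_j)$ with $f_j$ monic (resp. reversible). Write $\mathcal L,\mathcal B$ for the linearly recursive, resp. birecursive, $k$-sequences and $\widetilde{\mathcal L},\widetilde{\mathcal B}$ for the linearly recursive, resp. birecursive, $k$-bisequences. Let $\mathcal R\subseteq\mathcal L$ be the set of reversible sequences, i.e. those $u\in\mathcal L$ for which there is $w\in\widetilde{\mathcal L}$ with $w|_{\mathbb N_0^k}=u$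 and $\mathrm{An}(w)=\mathrm{An}(u)$, and let $\mathcal D=\{u\in\mathcal L:\ \mathbf x^{\mathbf d}\rightharpoonup u=0\text{ for some }\mathbf d\in\mathbb N_0^k\}$ be the degenerating sequences. $\mathcal L$, $\mathcal B$ and $\widetilde{\mathcal B}$ are $R$-bialgebras, with the pointwise (Hadamard) product, counit $u\mapsto u(\mathbf 0)$, and comultiplication $u\mapsto\sum_i v_i\otimes w_i$ determined by $u(\mathbf a+\mathbf b)=\sum_i v_i(\mathbf a)w_i(\mathbf b)$ for all $\mathbf a,\mathbf b$; for $\mathcal L$ this is the structure of the finite dual of the bialgebra $R[\mathbf x]$ in which all monomials are group-like. $\mathcal D$ is an ideal of $\mathcal L$. **Theorem.** 1. $\widetilde{\mathcal L}=\widetilde{\mathcal B}$ and $\mathcal B=\mathcal R$. In particular $\widetilde{\mathcal L}$ and $\mathcal R$ are bialgebras. 2. $\mathcal D$ is a subcoalgebra of $\mathcal L$ (with the same formulas for counit and comultiplication). For each $C$ among $\widetilde{\mathcal L},\widetilde{\mathcal B},\mathcal B$, with $\beta:C\to\mathcal L$ the restriction to $\mathbb N_0^k$ (resp. the inclusion),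 the direct sum $\mathcal D\oplus C$ of coalgebras is a bialgebra with product $(d,c)(d',c')=(dd'+d\,\beta(c')+\beta(c)\,d',\,cc')$ and unit $(0,1)$. 3. There are isomorphisms of $R$-bialgebras $$\mathcal L\simeq\mathcal D\oplus\widetilde{\mathcal L}=\mathcal D\oplus\widetilde{\mathcal B}\simeq\mathcal D\oplus\mathcal B=\mathcal D\oplus\mathcal R .$$ More precisely, the restriction $\beta:\widetilde{\mathcal L}\to\mathcal L$ is a bialgebra map. For every $u\in\mathcal L$ there is a unique bisequence $w=\gamma(u)$ obtained from $u$ by backsolving, that is, such that for some $\mathbf d\in\mathbb N_0^k$ and some reversible $q_1,\dots,q_k$ one has $x_j^{d_j}q_j(x_j)\in\mathrm{An}(u)$ and $q_j(x_j)\in\mathrm{An}(w)$ for all $j$, and $w(\mathbf n)=u(\mathbf n)$ for all $\mathbf n\ge\mathbf d$. The map $\gamma:\mathcal L\to\widetilde{\mathcal L}$ is a homomorphism of $R$-algebras compatible with the comultiplications, $\gamma\circ\beta=\mathrm{id}$ and $\ker\gamma=\mathcal D$. The first isomorphism is $u\mapsto(u-\beta\gamma(u),\gamma(u))$, and the second is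 $(d,w)\mapsto(d,w|_{\mathbb N_0^k})$. -/

import Mathlib

open scoped TensorProduct

noncomputable section

namespace RecSeq

/-! ### The coalgebra of a translation-closed space of functions -/

section Functions

set_option linter.unusedSectionVars false

variable {R : Type*} [CommRing R] {G : Type*} [AddCommMonoid G]
  {M : Type*} [AddCommGroup M] [Module R M]

/-- A module `M` of `R`-valued functions on the commutative monoid `G` (`ι` sends an element of `M`
to the function it is) that is closed under translations, and in which every finite set of
functions satisfies a common finite addition formula
`m (a + b) = ∑ i, m (a + g i) * e i b` with `e i ∈ M`. -/
structure IsRepresentative (ι : M →ₗ[R] (G → R)) : Prop where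
  injective : Function.Injective ι
  translate : ∀ (m : M) (a : G), ∃ m' : M, ∀ b, ι m' b = ι m (a + b)
  expand : ∀ S : Finset M, ∃ (n : ℕ) (g : Fin n → G) (e : Fin n → M),
    ∀ m ∈ S, ∀ a b, ι m (a + b) = ∑ i, ι m (a + g i) * ι (e i) b

/-- Evaluation at a point. -/
def evalAt (ι : M →ₗ[R] (G → R)) (a : G) : M →ₗ[R] R := LinearMap.proj a ∘ₗ ι

@[simp] theorem evalAt_apply (ι : M →ₗ[R] (G → R)) (a : G) (m : M) : evalAt ι a m = ι m a := rfl

/-- The canonical map sending `m ⊗ m'` to the function `(a, b) ↦ m a * m' b` of two variables. -/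
def toFun₂ (ι : M →ₗ[R] (G → R)) : M ⊗[R] M →ₗ[R] (G → G → R) :=
  LinearMap.pi fun a => LinearMap.pi fun b =>
    LinearMap.mul' R R ∘ₗ TensorProduct.map (evalAt ι a) (evalAt ι b)

@[simp] theorem toFun₂_tmul (ι : M →ₗ[R] (G → R)) (m m' : M) (a b : G) :
    toFun₂ ι (m ⊗ₜ m') a b = ι m a * ι m' b := rfl

/-- Evaluation of the first tensor factor at a point. -/
def evalLeft (ι : M →ₗ[R] (G → R)) (N : Type*) [AddCommGroup N] [Module R N] (a : G) :
    M ⊗[R] N →ₗ[R] N :=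
  (TensorProduct.lid R N).toLinearMap ∘ₗ (evalAt ι a).rTensor N

@[simp] theorem evalLeft_tmul (ι : M →ₗ[R] (G → R)) {N : Type*} [AddCommGroup N] [Module R N]
    (a : G) (m : M) (x : N) : evalLeft ι N a (m ⊗ₜ x) = ι m a • x := rfl

theorem apply_evalLeft (ι : M →ₗ[R] (G → R)) (t : M ⊗[R] M) (a b : G) :
    ι (evalLeft ι M a t) b = toFun₂ ι t a b := by
  induction t with
  | zero => simp
  | tmul x y => simp
  | add x y hx hy => simp [hx, hy]

theorem IsRepresentative.eq_zero_of_evalLeft {ι : M →ₗ[R] (G → R)} (h : IsRepresentative ι)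
    {N : Type*} [AddCommGroup N] [Module R N] (t : M ⊗[R] N)
    (ht : ∀ a, evalLeft ι N a t = 0) : t = 0 := by
  classical
  have key : ∀ t : M ⊗[R] N, ∃ S : Finset M, ∀ (n : ℕ) (g : Fin n → G) (e : Fin n → M),
      (∀ m ∈ S, m = ∑ i, ι m (g i) • e i) →
        t = ∑ i, e i ⊗ₜ[R] evalLeft ι N (g i) t := by
    intro t
    induction t with
    | zero => exact ⟨∅, fun n g e _ => by simp⟩
    | tmul x y =>
      refine ⟨{x}, fun n g e he => ?_⟩
      have hx := he x (by simp)
      conv_lhs => rw [hx]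
      rw [TensorProduct.sum_tmul]
      simp only [evalLeft_tmul, TensorProduct.tmul_smul, TensorProduct.smul_tmul']
    | add x y hx hy =>
      obtain ⟨S, hS⟩ := hx
      obtain ⟨T, hT⟩ := hy
      refine ⟨S ∪ T, fun n g e he => ?_⟩
      have h1 := hS n g e fun m hm => he m (Finset.mem_union_left _ hm)
      have h2 := hT n g e fun m hm => he m (Finset.mem_union_right _ hm)
      simp only [map_add, TensorProduct.tmul_add, Finset.sum_add_distrib]
      rw [← h1, ← h2]
  obtain ⟨S, hS⟩ := key t
  obtain ⟨n, g, e, hge⟩ := h.expand S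
  rw [hS n g e ?_]
  · simp [ht]
  · intro m hm
    apply h.injective
    funext b
    have := hge m hm 0 b
    simpa [Finset.sum_apply] using this

theorem IsRepresentative.toFun₂_injective {ι : M →ₗ[R] (G → R)} (h : IsRepresentative ι) :
    Function.Injective (toFun₂ ι) := by
  rw [injective_iff_map_eq_zero]
  intro t ht
  apply h.eq_zero_of_evalLeft
  intro a
  apply h.injective
  funext b
  rw [apply_evalLeft, ht]
  simp

/-- The map sending a function `m` to the function `(a, b) ↦ m (a + b)` of two variables. -/
def addFun (ι : M →ₗ[R] (G → R)) : M →ₗ[R] (G → G → R) :=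
  LinearMap.pi fun a => LinearMap.pi fun b => evalAt ι (a + b)

@[simp] theorem addFun_apply (ι : M →ₗ[R] (G → R)) (m : M) (a b : G) :
    addFun ι m a b = ι m (a + b) := rfl

theorem IsRepresentative.addFun_mem_range {ι : M →ₗ[R] (G → R)} (h : IsRepresentative ι) (m : M) :
    addFun ι m ∈ LinearMap.range (toFun₂ ι) := by
  obtain ⟨n, g, e, hge⟩ := h.expand {m}
  choose m' hm' using fun i => h.translate m (g i)
  refine ⟨∑ i, m' i ⊗ₜ e i, ?_⟩
  funext a b
  rw [addFun_apply, hge m (by simp) a b]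
  simp [Finset.sum_apply, hm', add_comm a]

/-- The comultiplication dual to the addition of `G`: `Δ m` is the unique element of `M ⊗ M` whose
associated function of two variables is `(a, b) ↦ m (a + b)`. -/
def comulOf (ι : M →ₗ[R] (G → R)) (h : IsRepresentative ι) : M →ₗ[R] M ⊗[R] M :=
  (LinearEquiv.ofInjective (toFun₂ ι) h.toFun₂_injective).symm.toLinearMap ∘ₗ
    (addFun ι).codRestrict (LinearMap.range (toFun₂ ι)) h.addFun_mem_range

theorem toFun₂_comulOf (ι : M →ₗ[R] (G → R)) (h : IsRepresentative ι) (m : M) (a b : G) :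
    toFun₂ ι (comulOf ι h m) a b = ι m (a + b) := by
  have := LinearEquiv.ofInjective_apply (toFun₂ ι) (h := h.toFun₂_injective) (comulOf ι h m)
  rw [← this]
  simp [comulOf]

/-- The coalgebra structure: comultiplication dual to addition in `G`, counit `m ↦ m 0`. -/
@[reducible] def coalgebraOf (ι : M →ₗ[R] (G → R)) (h : IsRepresentative ι) : Coalgebra R M where
  comul := comulOf ι h
  counit := evalAt ι 0
  coassoc := by
    ext m
    simp only [LinearMap.comp_apply, LinearEquiv.coe_coe]
    rw [← sub_eq_zero]
    apply h.eq_zero_of_evalLeft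
    intro a
    rw [map_sub, sub_eq_zero]
    apply h.toFun₂_injective
    funext b c
    have h1 : ∀ t : M ⊗[R] M, toFun₂ ι (evalLeft ι (M ⊗[R] M) a
        (TensorProduct.assoc R M M M ((comulOf ι h).rTensor M t))) b c =
          toFun₂ ι t (a + b) c := by
      intro t
      induction t with
      | zero => simp
      | tmul x y =>
        have h2 : ∀ s : M ⊗[R] M, toFun₂ ι (evalLeft ι (M ⊗[R] M) a
            (TensorProduct.assoc R M M M (s ⊗ₜ y))) b c = toFun₂ ι s a b * ι y c := by
          intro s
          induction s with
          | zero => simp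
          | tmul u v => simp [mul_assoc]
          | add u v hu hv => simp [TensorProduct.add_tmul, hu, hv, add_mul]
        rw [LinearMap.rTensor_tmul, h2, toFun₂_comulOf, toFun₂_tmul]
      | add x y hx hy => simp only [map_add, Pi.add_apply, hx, hy]
    have h3 : ∀ t : M ⊗[R] M, toFun₂ ι (evalLeft ι (M ⊗[R] M) a
        ((comulOf ι h).lTensor M t)) b c = toFun₂ ι t a (b + c) := by
      intro t
      induction t with
      | zero => simp
      | tmul x y => simp [toFun₂_comulOf]
      | add x y hx hy => simp only [map_add, Pi.add_apply, hx, hy]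
    rw [h1, h3, toFun₂_comulOf, toFun₂_comulOf, add_assoc]
  rTensor_counit_comp_comul := by
    ext m
    apply (TensorProduct.lid R M).injective
    apply h.injective
    funext b
    have := apply_evalLeft ι (comulOf ι h m) 0 b
    rw [toFun₂_comulOf, zero_add] at this
    simpa [evalLeft] using this
  lTensor_counit_comp_comul := by
    ext m
    apply (TensorProduct.rid R M).injective
    apply h.injective
    funext b
    have h1 : ∀ t : M ⊗[R] M, ι (TensorProduct.rid R M ((evalAt ι 0).lTensor M t)) b =
        toFun₂ ι t b 0 := by
      intro t
      induction t with
      | zero => simp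
      | tmul x y => simp [mul_comm]
      | add x y hx hy => simp only [map_add, Pi.add_apply, hx, hy]
    simp [h1, toFun₂_comulOf]

theorem toFun₂_mul {A : Type*} [CommRing A] [Algebra R A] (ι : A →ₐ[R] (G → R)) (s t : A ⊗[R] A)
    (a b : G) : toFun₂ ι.toLinearMap (s * t) a b =
      toFun₂ ι.toLinearMap s a b * toFun₂ ι.toLinearMap t a b := by
  induction s with
  | zero => simp
  | add x y hx hy => simp only [add_mul, map_add, Pi.add_apply, hx, hy]
  | tmul x y =>
    induction t with
    | zero => simp
    | add x y hx hy => simp only [mul_add, map_add, Pi.add_apply, hx, hy]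
    | tmul u v => simp [Algebra.TensorProduct.tmul_mul_tmul]; ring

/-- If the functions form an algebra under the pointwise product, the coalgebra above is a
bialgebra. -/
@[reducible] def bialgebraOf {A : Type*} [CommRing A] [Algebra R A] (ι : A →ₐ[R] (G → R))
    (h : IsRepresentative ι.toLinearMap) : Bialgebra R A :=
  letI := coalgebraOf ι.toLinearMap h
  Bialgebra.mk' R A
    (by
      change evalAt ι.toLinearMap 0 1 = 1
      simp)
    (by
      intro x y
      change evalAt ι.toLinearMap 0 (x * y) =
        evalAt ι.toLinearMap 0 x * evalAt ι.toLinearMap 0 y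
      simp)
    (by
      change comulOf ι.toLinearMap h 1 = 1
      apply h.toFun₂_injective
      funext a b
      rw [toFun₂_comulOf, Algebra.TensorProduct.one_def, toFun₂_tmul]
      simp)
    (by
      intro x y
      change comulOf ι.toLinearMap h (x * y) =
        comulOf ι.toLinearMap h x * comulOf ι.toLinearMap h y
      apply h.toFun₂_injective
      funext a b
      rw [toFun₂_mul, toFun₂_comulOf, toFun₂_comulOf, toFun₂_comulOf]
      simp)

end Functions

/-! ### Linearly recursive sequences and bisequences -/

section Recursive

open Polynomial

variable {R : Type*} [CommRing R] {k : ℕ}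
  {Z : Type*} [CommSemiring Z]

/-- The vector of exponents of a monomial, as an element of `Z ^ k` (with `Z = ℕ` or `Z = ℤ`). -/
def expo (Z : Type*) [CommSemiring Z] {k : ℕ} (i : Fin k →₀ ℕ) : Fin k → Z := fun j => (i j : Z)

@[simp] theorem expo_apply (i : Fin k →₀ ℕ) (j : Fin k) : expo Z i j = (i j : Z) := rfl

theorem expo_add (i i' : Fin k →₀ ℕ) : expo Z (i + i') = expo Z i + expo Z i' := by
  funext j; simp

@[simp] theorem expo_zero : expo Z (0 : Fin k →₀ ℕ) = 0 := by
  funext j; simp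

/-- The action of `R[x₁, …, x_k]` on `k`-sequences (`Z = ℕ`) and on `k`-bisequences (`Z = ℤ`):
for `f = ∑ i, a i * x ^ i` one has `(f ⇀ w) n = ∑ i, a i * w (n + i)`. -/
def act (f : MvPolynomial (Fin k) R) (w : (Fin k → Z) → R) : (Fin k → Z) → R :=
  fun n => ∑ i ∈ f.support, f.coeff i * w (n + expo Z i)

/-- The annihilator of a `k`-sequence or `k`-bisequence in `R[x₁, …, x_k]`. -/
def annih (w : (Fin k → Z) → R) : Set (MvPolynomial (Fin k) R) := {f | act f w = 0}

/-- The monic polynomials in one variable. -/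
def monicPolys (R : Type*) [CommRing R] : Submonoid R[X] where
  carrier := {f | f.Monic}
  mul_mem' := Monic.mul
  one_mem' := monic_one

/-- The reversible polynomials: monic with invertible constant term. -/
def reversiblePolys (R : Type*) [CommRing R] : Submonoid R[X] where
  carrier := {f | f.Monic ∧ IsUnit (f.eval 0)}
  mul_mem' := fun hf hg => ⟨hf.1.mul hg.1, by simpa using And.intro hf.2 hg.2⟩
  one_mem' := ⟨monic_one, by simp⟩

/-- The polynomial `f(x_j)` in `R[x₁, …, x_k]`. -/
def inVar (j : Fin k) (f : R[X]) : MvPolynomial (Fin k) R := aeval (MvPolynomial.X j) f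

/-- `I` contains, for each `j`, a polynomial `f_j(x_j)` with `f_j ∈ P`. For `P` the monic
(reversible) polynomials this is the notion of a monic (reversible) ideal. -/
def ContainsElementary (P : Submonoid R[X]) (I : Set (MvPolynomial (Fin k) R)) : Prop :=
  ∀ j, ∃ f ∈ P, inVar j f ∈ I

/-! Algebra of the action. -/

theorem act_eq_sum {f : MvPolynomial (Fin k) R} {s : Finset (Fin k →₀ ℕ)} (hs : f.support ⊆ s)
    (w : (Fin k → Z) → R) (n : Fin k → Z) :
    act f w n = ∑ i ∈ s, f.coeff i * w (n + expo Z i) := by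
  unfold act
  refine Finset.sum_subset hs fun i _ hi => ?_
  rw [MvPolynomial.notMem_support_iff.mp hi, zero_mul]

theorem act_add (f g : MvPolynomial (Fin k) R) (w : (Fin k → Z) → R) :
    act (f + g) w = act f w + act g w := by
  classical
  funext n
  rw [Pi.add_apply, act_eq_sum (s := f.support ∪ g.support) MvPolynomial.support_add,
    act_eq_sum (f := f) Finset.subset_union_left, act_eq_sum (f := g) Finset.subset_union_right,
    ← Finset.sum_add_distrib]
  simp [add_mul]

theorem act_monomial (d : Fin k →₀ ℕ) (a : R) (w : (Fin k → Z) → R) (n : Fin k → Z) :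
    act (MvPolynomial.monomial d a) w n = a * w (n + expo Z d) := by
  rw [act_eq_sum MvPolynomial.support_monomial_subset]
  simp

@[simp] theorem act_zero_left (w : (Fin k → Z) → R) :
    act (0 : MvPolynomial (Fin k) R) w = 0 := by
  funext n; simp [act]

theorem act_add_right (f : MvPolynomial (Fin k) R) (v w : (Fin k → Z) → R) :
    act f (v + w) = act f v + act f w := by
  funext n; simp [act, mul_add, Finset.sum_add_distrib]

theorem act_smul_right (f : MvPolynomial (Fin k) R) (r : R) (w : (Fin k → Z) → R) :
    act f (r • w) = r • act f w := by
  funext n; simp [act, Finset.mul_sum, mul_left_comm]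

@[simp] theorem act_zero_right (f : MvPolynomial (Fin k) R) :
    act f (0 : (Fin k → Z) → R) = 0 := by
  funext n; simp [act]

theorem act_mul (f g : MvPolynomial (Fin k) R) (w : (Fin k → Z) → R) :
    act (f * g) w = act f (act g w) := by
  induction f using MvPolynomial.induction_on' with
  | add p q hp hq => rw [add_mul, act_add, act_add, hp, hq]
  | monomial d a =>
    induction g using MvPolynomial.induction_on' with
    | add p q hp hq => rw [mul_add, act_add, act_add, act_add_right, hp, hq]
    | monomial e b =>
      funext n
      rw [MvPolynomial.monomial_mul, act_monomial, act_monomial, act_monomial, expo_add, mul_assoc,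
        add_assoc]

/-- The annihilator as an ideal. -/
def annihIdeal (w : (Fin k → Z) → R) : Ideal (MvPolynomial (Fin k) R) where
  carrier := annih w
  add_mem' := by
    intro f g hf hg
    change act _ _ = 0
    rw [act_add, show act f w = 0 from hf, show act g w = 0 from hg, add_zero]
  zero_mem' := act_zero_left w
  smul_mem' := by
    intro c f hf
    change act (c * f) _ = 0
    rw [act_mul, show act f w = 0 from hf, act_zero_right]

@[simp] theorem mem_annihIdeal {w : (Fin k → Z) → R} {f : MvPolynomial (Fin k) R} :
    f ∈ annihIdeal w ↔ act f w = 0 := Iff.rfl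

theorem act_sub (f g : MvPolynomial (Fin k) R) (w : (Fin k → Z) → R) :
    act (f - g) w = act f w - act g w := by
  rw [eq_sub_iff_add_eq, ← act_add, sub_add_cancel]

theorem act_one (w : (Fin k → Z) → R) : act (1 : MvPolynomial (Fin k) R) w = w := by
  funext n
  have := act_monomial (0 : Fin k →₀ ℕ) (1 : R) w n
  simpa using this

theorem inVar_mul (j : Fin k) (f g : R[X]) : inVar j (f * g) = inVar j f * inVar j g := by
  simp [inVar]

theorem act_inVar_of_dvd {j : Fin k} {f g : R[X]} (h : f ∣ g) {w : (Fin k → Z) → R}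
    (hf : act (inVar j f) w = 0) : act (inVar j g) w = 0 := by
  obtain ⟨c, rfl⟩ := h
  rw [mul_comm, inVar_mul, act_mul, hf, act_zero_right]

theorem act_inVar (j : Fin k) (f : R[X]) (w : (Fin k → Z) → R) (n : Fin k → Z) :
    act (inVar j f) w n = ∑ i ∈ f.support, f.coeff i * w (n + Pi.single j (i : Z)) := by
  have key : ∀ (f : R[X]), act (inVar j f) w n =
      f.sum fun i a => a * w (n + Pi.single j (i : Z)) := by
    intro f
    induction f using Polynomial.induction_on' with
    | add p q hp hq =>
      rw [Polynomial.sum_add_index _ _ _ (by simp) (by simp [add_mul]), ← hp, ← hq]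
      simp [inVar, act_add]
    | monomial m a =>
      rw [Polynomial.sum_monomial_index _ _ (by simp)]
      have : inVar j (Polynomial.monomial m a) =
          MvPolynomial.monomial (Finsupp.single j m) a := by
        simp [inVar, Polynomial.aeval_monomial, MvPolynomial.algebraMap_eq,
          MvPolynomial.monomial_eq]
      rw [this, act_monomial]
      congr 3
      funext l
      by_cases h : l = j
      · subst h; simp
      · simp [h]
  exact key f

/-- A unit of a finite `R`-algebra is a root of a reversible polynomial. -/
theorem exists_reversible_of_isUnit {A : Type*} [CommRing A] [Algebra R A] [Module.Finite R A]
    {z : A} (hz : IsUnit z) : ∃ q ∈ reversiblePolys R, aeval z q = 0 := by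
  rcases subsingleton_or_nontrivial R with hR | hR
  · exact ⟨1, (reversiblePolys R).one_mem, by
      rw [Subsingleton.elim (1 : R[X]) 0, map_zero]⟩
  obtain ⟨y, hy⟩ := hz.exists_right_inv
  obtain ⟨g, hg, hgz⟩ := Algebra.IsIntegral.isIntegral (R := R) z
  obtain ⟨p, hp, hpy⟩ := Algebra.IsIntegral.isIntegral (R := R) y
  have hrev : aeval z p.reverse = 0 := by
    let hinv : Invertible y := ⟨z, hy, by rw [mul_comm, hy]⟩
    have h1 := Polynomial.eval₂_reverse_eq_zero_iff (algebraMap R A) y p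
    exact h1.mpr hpy
  have hmon : (X ^ (p.natDegree + 1) * g).Monic := (monic_X_pow _).mul hg
  refine ⟨X ^ (p.natDegree + 1) * g + p.reverse, ⟨?_, ?_⟩, ?_⟩
  · apply hmon.add_of_left
    apply degree_lt_degree
    rw [(monic_X_pow _).natDegree_mul hg, natDegree_X_pow]
    have := reverse_natDegree_le p
    omega
  · have : eval 0 p.reverse = 1 := by
      rw [← coeff_zero_eq_eval_zero, coeff_zero_reverse, hp.leadingCoeff]
    simp [this]
  · rw [map_add, hrev, map_mul, aeval_def z g, hgz, mul_zero, add_zero]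

/-- Closure properties of a set `P` of characteristic polynomials which make the functions with
characteristic polynomials in `P` an algebra. -/
structure IsCharClass (P : Submonoid R[X]) : Prop where
  monic : ∀ f ∈ P, f.Monic
  X_sub_one : (X - 1 : R[X]) ∈ P
  tensor : ∀ f ∈ P, ∀ g ∈ P, ∃ h ∈ P,
    aeval ((AdjoinRoot.root f) ⊗ₜ[R] (AdjoinRoot.root g)) h = 0

theorem isCharClass_monic : IsCharClass (monicPolys R) where
  monic := fun _ hf => hf
  X_sub_one := monic_X_sub_C (1 : R)
  tensor := by
    intro f hf g hg
    have := Polynomial.Monic.finite_adjoinRoot (R := R) hf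
    have := Polynomial.Monic.finite_adjoinRoot (R := R) hg
    obtain ⟨h, hh, hz⟩ := Algebra.IsIntegral.isIntegral (R := R)
      ((AdjoinRoot.root f) ⊗ₜ[R] (AdjoinRoot.root g))
    exact ⟨h, hh, hz⟩

theorem isUnit_root {f : R[X]} (hf : f ∈ reversiblePolys R) : IsUnit (AdjoinRoot.root f) := by
  obtain ⟨a, ha⟩ : X ∣ f - C (f.eval 0) := by
    rw [X_dvd_iff]; simp [coeff_zero_eq_eval_zero]
  have h2 : AdjoinRoot.root f * AdjoinRoot.mk f (-a) = AdjoinRoot.of f (f.eval 0) := by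
    have := congrArg (AdjoinRoot.mk f) ha
    simp only [map_sub, AdjoinRoot.mk_self, map_mul, AdjoinRoot.mk_X, AdjoinRoot.mk_C] at this
    rw [map_neg, mul_neg, ← this]; simp
  have h3 : IsUnit (AdjoinRoot.of f (f.eval 0)) := hf.2.map _
  rw [← h2] at h3
  exact isUnit_of_mul_isUnit_left h3

theorem isCharClass_reversible : IsCharClass (reversiblePolys R) where
  monic := fun _ hf => hf.1
  X_sub_one := ⟨monic_X_sub_C (1 : R), by simp⟩
  tensor := by
    intro f hf g hg
    have := Polynomial.Monic.finite_adjoinRoot (R := R) hf.1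
    have := Polynomial.Monic.finite_adjoinRoot (R := R) hg.1
    apply exists_reversible_of_isUnit
    have h1 := (isUnit_root hf).map
      (Algebra.TensorProduct.includeLeft : AdjoinRoot f →ₐ[R] AdjoinRoot f ⊗[R] AdjoinRoot g)
    have h2 := (isUnit_root hg).map
      (Algebra.TensorProduct.includeRight : AdjoinRoot g →ₐ[R] AdjoinRoot f ⊗[R] AdjoinRoot g)
    simpa using h1.mul h2

/-- The action on a fixed `w` by polynomials in the `j`-th variable. -/
def actVar (j : Fin k) (w : (Fin k → Z) → R) : R[X] →ₗ[R] ((Fin k → Z) → R) where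
  toFun p := act (inVar j p) w
  map_add' p q := by simp [inVar, act_add]
  map_smul' r p := by
    funext n
    simp only [inVar, map_smul, MvPolynomial.smul_eq_C_mul, act_mul, RingHom.id_apply,
      Pi.smul_apply, smul_eq_mul, MvPolynomial.C_apply, act_monomial]
    simp

/-- The action on `w` of the quotient `R[x] / (f)`, if `f(x_j)` annihilates `w`. -/
def actRoot (j : Fin k) {f : R[X]} (hf : f.Monic) (w : (Fin k → Z) → R) :
    AdjoinRoot f →ₗ[R] ((Fin k → Z) → R) :=
  actVar j w ∘ₗ AdjoinRoot.modByMonicHom hf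

theorem actRoot_mk (j : Fin k) {f : R[X]} (hf : f.Monic) {w : (Fin k → Z) → R}
    (hw : act (inVar j f) w = 0) (p : R[X]) :
    actRoot j hf w (AdjoinRoot.mk f p) = act (inVar j p) w := by
  rw [actRoot, LinearMap.comp_apply, AdjoinRoot.modByMonicHom_mk]
  change act (inVar j (p %ₘ f)) w = _
  conv_rhs => rw [← modByMonic_add_div p f]
  have : act (inVar j (f * (p /ₘ f))) w = 0 := act_inVar_of_dvd (dvd_mul_right _ _) hw
  have h2 : inVar j (p %ₘ f + f * (p /ₘ f)) = inVar j (p %ₘ f) + inVar j (f * (p /ₘ f)) := by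
    simp [inVar]
  rw [h2, act_add, this, add_zero]

theorem act_inVar_X_pow (j : Fin k) (m : ℕ) (w : (Fin k → Z) → R) (n : Fin k → Z) :
    act (inVar j (X ^ m)) w n = w (n + Pi.single j (m : Z)) := by
  rw [act_inVar]
  rcases subsingleton_or_nontrivial R with hR | hR
  · exact Subsingleton.elim _ _
  · simp [support_X_pow, coeff_X_pow]

theorem actRoot_root_pow (j : Fin k) {f : R[X]} (hf : f.Monic) {w : (Fin k → Z) → R}
    (hw : act (inVar j f) w = 0) (m : ℕ) (n : Fin k → Z) :
    actRoot j hf w (AdjoinRoot.root f ^ m) n = w (n + Pi.single j (m : Z)) := by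
  rw [← AdjoinRoot.mk_X, ← map_pow, actRoot_mk j hf hw, act_inVar_X_pow]

theorem act_inVar_X_sub_one (j : Fin k) (w : (Fin k → Z) → R)
    (h : ∀ n, w (n + Pi.single j 1) = w n) : act (inVar j (X - 1)) w = 0 := by
  have h1 : inVar j (X - 1 : R[X]) = inVar j (X ^ 1) - 1 := by simp [inVar]
  rw [h1, act_sub, act_one, sub_eq_zero]
  funext n
  rw [act_inVar_X_pow]
  simpa using h n

/-- The algebra, under the pointwise (Hadamard) product, of the functions `w` on `Z ^ k` whose
annihilator contains for each `j` some `f_j(x_j)` with `f_j ∈ P`. -/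
def recAlg (Z : Type*) [CommSemiring Z] (k : ℕ) {P : Submonoid R[X]} (hP : IsCharClass P) :
    Subalgebra R ((Fin k → Z) → R) where
  carrier := {w | ContainsElementary P (annih w)}
  add_mem' := by
    intro u v hu hv j
    obtain ⟨f, hf, hfu⟩ := hu j
    obtain ⟨g, hg, hgv⟩ := hv j
    refine ⟨f * g, P.mul_mem hf hg, ?_⟩
    change act _ _ = 0
    rw [act_add_right, act_inVar_of_dvd (dvd_mul_right f g) hfu,
      act_inVar_of_dvd (dvd_mul_left g f) hgv, add_zero]
  algebraMap_mem' := fun r j => ⟨X - 1, hP.X_sub_one, act_inVar_X_sub_one _ _ fun _ => rfl⟩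
  mul_mem' := by
    intro u v hu hv j
    obtain ⟨f, hf, hfu⟩ := hu j
    obtain ⟨g, hg, hgv⟩ := hv j
    obtain ⟨h, hh, hz⟩ := hP.tensor f hf g hg
    refine ⟨h, hh, ?_⟩
    change act _ _ = 0
    funext n
    have h1 := congrArg (LinearMap.mul' R R ∘ₗ TensorProduct.map
      (LinearMap.proj n ∘ₗ actRoot j (hP.monic f hf) u)
      (LinearMap.proj n ∘ₗ actRoot j (hP.monic g hg) v)) hz
    rw [aeval_def, eval₂_eq_sum, Polynomial.sum, map_sum, map_zero] at h1
    rw [act_inVar, Pi.zero_apply, ← h1]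
    refine Finset.sum_congr rfl fun i _ => ?_
    rw [← Algebra.smul_def, map_smul, Algebra.TensorProduct.tmul_pow, LinearMap.comp_apply,
      TensorProduct.map_tmul, LinearMap.mul'_apply, LinearMap.comp_apply, LinearMap.comp_apply,
      LinearMap.proj_apply, LinearMap.proj_apply, actRoot_root_pow j _ hfu, actRoot_root_pow j _ hgv,
      Pi.mul_apply, smul_eq_mul]

theorem mem_recAlg {P : Submonoid R[X]} {hP : IsCharClass P} {w : (Fin k → Z) → R} :
    w ∈ recAlg Z k hP ↔ ContainsElementary P (annih w) := Iff.rfl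
/-- Existence of addition formulas in one variable for functions with characteristic polynomial in
`P`, with coefficients that again have characteristic polynomial in `P`. -/
def IsExpandable (Z : Type*) [CommSemiring Z] (P : Submonoid R[X]) : Prop :=
  ∀ f ∈ P, ∃ (N : ℕ) (E : Fin N → Z → R),
    (∀ t z, ∑ i ∈ f.support, f.coeff i * E t (z + (i : Z)) = 0) ∧
    ∀ (k : ℕ) (j : Fin k) (w : (Fin k → Z) → R), act (inVar j f) w = 0 →
      ∀ (n : Fin k → Z) (z : Z), w (n + Pi.single j z) = ∑ t, E t z * w (n + Pi.single j ((t : ℕ) : Z))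

theorem isExpandable_of {P : Submonoid R[X]} (hP : IsCharClass P)
    (φ : ∀ f ∈ P, Z → AdjoinRoot f)
    (h1 : ∀ f hf z (i : ℕ), φ f hf (z + (i : Z)) = φ f hf z * AdjoinRoot.root f ^ i)
    (h2 : ∀ f (hf : f ∈ P) (k : ℕ) (j : Fin k) (w : (Fin k → Z) → R), act (inVar j f) w = 0 →
      ∀ n z, actRoot j (hP.monic f hf) w (φ f hf z) n = w (n + Pi.single j z)) :
    IsExpandable Z P := by
  intro f hf
  let B := AdjoinRoot.powerBasis' (hP.monic f hf)
  refine ⟨B.dim, fun t z => B.basis.repr (φ f hf z) t, ?_, ?_⟩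
  · intro t z
    have h3 : ∑ i ∈ f.support, f.coeff i • φ f hf (z + (i : Z)) = 0 := by
      simp only [h1]
      have h4 : aeval (AdjoinRoot.root f) f = 0 := AdjoinRoot.aeval_eq f ▸ AdjoinRoot.mk_self
      rw [aeval_def, eval₂_eq_sum, Polynomial.sum] at h4
      calc _ = φ f hf z * ∑ i ∈ f.support,
              algebraMap R (AdjoinRoot f) (f.coeff i) * AdjoinRoot.root f ^ i := by
            rw [Finset.mul_sum]
            refine Finset.sum_congr rfl fun i _ => ?_
            rw [Algebra.smul_def]; ring
        _ = 0 := by rw [h4, mul_zero]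
    have h5 := congrArg (fun y => B.basis.repr y t) h3
    simpa [Finsupp.finsetSum_apply] using h5
  · intro k j w hw n z
    rw [← h2 f hf k j w hw n z]
    conv_lhs => rw [← B.basis.sum_repr (φ f hf z)]
    rw [map_sum, Finset.sum_apply]
    refine Finset.sum_congr rfl fun t _ => ?_
    rw [map_smul, Pi.smul_apply, smul_eq_mul, B.basis_eq_pow]
    congr 1
    exact actRoot_root_pow j _ hw t n

theorem isExpandable_nat {P : Submonoid R[X]} (hP : IsCharClass P) : IsExpandable ℕ P :=
  isExpandable_of hP (fun f _ z => AdjoinRoot.root f ^ z)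
    (fun f _ z i => by simp [pow_add])
    (fun f hf k j w hw n z => actRoot_root_pow j _ hw z n)

theorem isExpandable_int : IsExpandable ℤ (reversiblePolys R) := by
  refine isExpandable_of isCharClass_reversible
    (fun f hf z => (((isUnit_root hf).unit ^ z : (AdjoinRoot f)ˣ) : AdjoinRoot f)) ?_ ?_
  · intro f hf z i
    simp [zpow_add]
  · intro f hf k j w hw n z
    have hmul : ∀ (m : ℕ) (y : AdjoinRoot f) (n : Fin k → ℤ),
        actRoot j hf.1 w (AdjoinRoot.root f ^ m * y) n =
          actRoot j hf.1 w y (n + Pi.single j (m : ℤ)) := by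
      intro m y n
      induction y using AdjoinRoot.induction_on with
      | ih p =>
        rw [← AdjoinRoot.mk_X, ← map_pow, ← map_mul, actRoot_mk j hf.1 hw, actRoot_mk j hf.1 hw,
          inVar_mul, act_mul, act_inVar_X_pow]
    obtain ⟨m, rfl | rfl⟩ := z.eq_nat_or_neg
    · rw [zpow_natCast, Units.val_pow_eq_pow_val]
      exact actRoot_root_pow j _ hw m n
    · have h1 := hmul m (((isUnit_root hf).unit ^ (-(m : ℤ)) : (AdjoinRoot f)ˣ) : AdjoinRoot f)
        (n + Pi.single j (-(m : ℤ)))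
      rw [add_assoc, ← Pi.single_add, neg_add_cancel, Pi.single_zero, add_zero] at h1
      rw [← h1]
      have h2 : AdjoinRoot.root f ^ m *
          (((isUnit_root hf).unit ^ (-(m : ℤ)) : (AdjoinRoot f)ˣ) : AdjoinRoot f) = 1 := by
        have : AdjoinRoot.root f ^ m = (((isUnit_root hf).unit ^ m : (AdjoinRoot f)ˣ) :
          AdjoinRoot f) := by simp
        rw [this, ← Units.val_mul, zpow_neg, zpow_natCast, mul_inv_cancel, Units.val_one]
      rw [h2, ← pow_zero (AdjoinRoot.root f), actRoot_root_pow j _ hw]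
      simp

theorem act_translate (f : MvPolynomial (Fin k) R) (w : (Fin k → Z) → R) (a n : Fin k → Z) :
    act f (fun b => w (a + b)) n = act f w (a + n) := by
  simp [act, add_assoc]

theorem exists_common {P : Submonoid R[X]} (hP : IsCharClass P) (S : Finset (recAlg Z k hP))
    (j : Fin k) : ∃ f ∈ P, ∀ m ∈ S, act (inVar j f) (m : (Fin k → Z) → R) = 0 := by
  classical
  induction S using Finset.induction_on with
  | empty => exact ⟨1, P.one_mem, by simp⟩
  | insert a S _ ih =>
    obtain ⟨f, hf, hfS⟩ := ih
    obtain ⟨g, hg, hga⟩ := a.2 j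
    refine ⟨f * g, P.mul_mem hf hg, fun m hm => ?_⟩
    rcases Finset.mem_insert.mp hm with rfl | hm
    · exact act_inVar_of_dvd (dvd_mul_left g f) hga
    · exact act_inVar_of_dvd (dvd_mul_right f g) (hfS m hm)

theorem isRepresentative_recAlg {P : Submonoid R[X]} (hP : IsCharClass P)
    (hE : IsExpandable Z P) (k : ℕ) :
    IsRepresentative (recAlg Z k hP).val.toLinearMap where
  injective := Subtype.val_injective
  translate := by
    intro m a
    refine ⟨⟨fun b => (m : (Fin k → Z) → R) (a + b), fun j => ?_⟩, fun b => rfl⟩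
    obtain ⟨f, hf, hfm⟩ := m.2 j
    refine ⟨f, hf, ?_⟩
    change act _ _ = 0
    funext n
    rw [act_translate, show act (inVar j f) (m : (Fin k → Z) → R) = 0 from hfm]
    rfl
  expand := by
    classical
    intro S
    choose f hf hfS using exists_common hP S
    choose N E hE1 hE2 using fun j => hE (f j) (hf j)
    have hmem : ∀ j t, (fun b : Fin k → Z => E j t (b j)) ∈ recAlg Z k hP := by
      intro j t l
      by_cases hl : l = j
      · subst hl
        refine ⟨f l, hf l, ?_⟩
        change act _ _ = 0
        funext n
        rw [act_inVar]
        simpa using hE1 l t (n l)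
      · refine ⟨X - 1, hP.X_sub_one, act_inVar_X_sub_one _ _ fun n => ?_⟩
        simp [Ne.symm hl]
    have key : ∀ T : Finset (Fin k), ∃ (κ : Type) (_ : Fintype κ) (g : κ → Fin k → Z)
        (e : κ → recAlg Z k hP), ∀ m ∈ S, ∀ a b : Fin k → Z, (m : (Fin k → Z) → R) (a + b) =
          ∑ i, (m : (Fin k → Z) → R) (a + g i + fun j => if j ∈ T then 0 else b j) *
            (e i : (Fin k → Z) → R) b := by
      intro T
      induction T using Finset.induction_on with
      | empty => exact ⟨Unit, inferInstance, fun _ => 0, fun _ => 1, fun m _ a b => by simp⟩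
      | insert j T hj ih =>
        obtain ⟨κ, _, g, e, hge⟩ := ih
        refine ⟨κ × Fin (N j), inferInstance, fun i => g i.1 + Pi.single j ((i.2 : ℕ) : Z),
          fun i => e i.1 * ⟨_, hmem j i.2⟩, fun m hm a b => ?_⟩
        rw [hge m hm a b, Fintype.sum_prod_type]
        refine Finset.sum_congr rfl fun i _ => ?_
        have h1 : (fun l => if l ∈ T then 0 else b l) =
            (fun l => if l ∈ insert j T then 0 else b l) + Pi.single j (b j) := by
          funext l
          by_cases hl : l = j
          · subst hl; simp [hj]
          · simp [hl]
        rw [h1, ← add_assoc, hE2 j k j _ (hfS j m hm), Finset.sum_mul]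
        refine Finset.sum_congr rfl fun t _ => ?_
        have h2 : a + g i + (fun l => if l ∈ insert j T then 0 else b l) +
            Pi.single j ((t : ℕ) : Z) = a + (g i + Pi.single j ((t : ℕ) : Z)) +
              fun l => if l ∈ insert j T then 0 else b l := by
          abel
        rw [h2]
        change _ = _ * ((e i : (Fin k → Z) → R) b * E j t (b j))
        ring
    obtain ⟨κ, _, g, e, hge⟩ := key Finset.univ
    refine ⟨Fintype.card κ, fun i => g ((Fintype.equivFin κ).symm i),
      fun i => e ((Fintype.equivFin κ).symm i), fun m hm a b => ?_⟩
    have h3 := hge m hm a b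
    rw [← (Fintype.equivFin κ).symm.sum_comp] at h3
    have h4 : (fun j : Fin k => if j ∈ Finset.univ then 0 else b j) = 0 := by
      funext j; simp
    rw [h4] at h3
    simpa using h3

/-! ### The four algebras of sequences, and restriction of bisequences -/

/-- The linearly recursive `k`-sequences over `R`, with the Hadamard product. -/
abbrev linRec (R : Type*) [CommRing R] (k : ℕ) : Subalgebra R ((Fin k → ℕ) → R) :=
  recAlg ℕ k (isCharClass_monic (R := R))

/-- The linearly birecursive `k`-sequences over `R`. -/
abbrev birec (R : Type*) [CommRing R] (k : ℕ) : Subalgebra R ((Fin k → ℕ) → R) :=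
  recAlg ℕ k (isCharClass_reversible (R := R))

/-- The linearly recursive `k`-bisequences over `R`. -/
abbrev linRecBi (R : Type*) [CommRing R] (k : ℕ) : Subalgebra R ((Fin k → ℤ) → R) :=
  recAlg ℤ k (isCharClass_monic (R := R))

/-- The linearly birecursive `k`-bisequences over `R`. -/
abbrev birecBi (R : Type*) [CommRing R] (k : ℕ) : Subalgebra R ((Fin k → ℤ) → R) :=
  recAlg ℤ k (isCharClass_reversible (R := R))

/-- The restriction of a `k`-bisequence to `ℕ ^ k`. -/
def restr (w : (Fin k → ℤ) → R) : (Fin k → ℕ) → R := fun n => w fun j => (n j : ℤ)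

/-- The reversible `k`-sequences: the linearly recursive `u` having a linearly recursive
bisequence `w` as reverse, i.e. `w` restricts to `u` and has the same annihilator in
`R[x₁, …, x_k]`. -/
def reversibleSeqs (R : Type*) [CommRing R] (k : ℕ) : Set ((Fin k → ℕ) → R) :=
  {u | u ∈ linRec R k ∧ ∃ w ∈ linRecBi R k, restr w = u ∧ annih w = annih u}

theorem act_restr (f : MvPolynomial (Fin k) R) (w : (Fin k → ℤ) → R) :
    act f (restr w) = restr (act f w) := by
  funext n
  refine Finset.sum_congr rfl fun i _ => ?_
  have : (fun j => ((n + expo ℕ i) j : ℤ)) = (fun j => (n j : ℤ)) + expo ℤ i := by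
    funext j; simp
  rw [restr, this]

/-- Restriction of bisequences to `ℕ ^ k`, as an algebra map. -/
def restrict {P : Submonoid R[X]} (hP : IsCharClass P) (k : ℕ) :
    recAlg ℤ k hP →ₐ[R] recAlg ℕ k hP where
  toFun w := ⟨restr w, fun j => by
    obtain ⟨f, hf, hw⟩ := w.2 j
    refine ⟨f, hf, ?_⟩
    change act _ _ = 0
    rw [act_restr, show act (inVar j f) (w : (Fin k → ℤ) → R) = 0 from hw]
    rfl⟩
  map_one' := rfl
  map_mul' _ _ := rfl
  map_zero' := rfl
  map_add' _ _ := rfl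
  commutes' _ := rfl

theorem birec_le_linRec : birec R k ≤ linRec R k := fun _ hu j =>
  let ⟨f, hf, hfu⟩ := hu j
  ⟨f, hf.1, hfu⟩

/-- The inclusion of the birecursive sequences into the linearly recursive ones. -/
def birecIncl (R : Type*) [CommRing R] (k : ℕ) : birec R k →ₐ[R] linRec R k :=
  Subalgebra.inclusion birec_le_linRec

/-- Restriction of linearly recursive bisequences. -/
def linRecBiRestr (R : Type*) [CommRing R] (k : ℕ) : linRecBi R k →ₐ[R] linRec R k :=
  restrict isCharClass_monic k

/-- Restriction of birecursive bisequences, to linearly recursive sequences. -/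
def birecBiRestr (R : Type*) [CommRing R] (k : ℕ) : birecBi R k →ₐ[R] linRec R k :=
  (birecIncl R k).comp (restrict isCharClass_reversible k)

/-- The degenerating sequences among the linearly recursive ones: those annihilated by some
monomial `x ^ d`. They form an ideal for the Hadamard product. -/
def degen (R : Type*) [CommRing R] (k : ℕ) : Ideal (linRec R k) where
  carrier := {u | ∃ d : Fin k →₀ ℕ,
    act (MvPolynomial.monomial d (1 : R)) (u : (Fin k → ℕ) → R) = 0}
  add_mem' := by
    rintro u v ⟨d, hd⟩ ⟨e, he⟩
    refine ⟨d + e, ?_⟩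
    have h1 : MvPolynomial.monomial (d + e) (1 : R) =
        MvPolynomial.monomial e 1 * MvPolynomial.monomial d 1 := by
      rw [MvPolynomial.monomial_mul, add_comm, one_mul]
    have h2 : MvPolynomial.monomial (d + e) (1 : R) =
        MvPolynomial.monomial d 1 * MvPolynomial.monomial e 1 := by
      rw [MvPolynomial.monomial_mul, one_mul]
    have h3 : ((u + v : linRec R k) : (Fin k → ℕ) → R) = u + v := rfl
    rw [h3, act_add_right]
    nth_rewrite 1 [h1]
    rw [h2, act_mul, act_mul, hd, he, act_zero_right, act_zero_right, add_zero]
  zero_mem' := ⟨0, act_zero_right _⟩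
  smul_mem' := by
    rintro c u ⟨d, hd⟩
    refine ⟨d, ?_⟩
    funext n
    have h1 := congrFun hd n
    rw [act_monomial] at h1 ⊢
    change 1 * ((c : (Fin k → ℕ) → R) _ * (u : (Fin k → ℕ) → R) _) = 0
    rw [one_mul, Pi.zero_apply] at h1
    rw [h1, mul_zero, mul_zero]

/-- The inclusion of the degenerating sequences into all functions on `ℕ ^ k`. -/
def degenVal (R : Type*) [CommRing R] (k : ℕ) : degen R k →ₗ[R] ((Fin k → ℕ) → R) where
  toFun u := (u : linRec R k)
  map_add' _ _ := rfl
  map_smul' _ _ := rfl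

/-! ### Artinian coefficient rings -/

theorem exists_dvd_X_pow_mul [IsArtinianRing R] {f : R[X]} (hf : f.Monic) :
    ∃ (d : ℕ), ∃ q ∈ reversiblePolys R, f ∣ X ^ d * q := by
  have := Polynomial.Monic.finite_adjoinRoot (R := R) hf
  have hA : IsArtinianRing (AdjoinRoot f) := isArtinian_of_tower R inferInstance
  obtain ⟨n, y, hy⟩ := IsArtinian.exists_pow_succ_smul_dvd (AdjoinRoot.root f) (1 : AdjoinRoot f)
  let I : Ideal (AdjoinRoot f) := LinearMap.ker (LinearMap.mulLeft (AdjoinRoot f) (AdjoinRoot.root f ^ n))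
  have hI : ∀ a, a ∈ I ↔ AdjoinRoot.root f ^ n * a = 0 := fun a => Iff.rfl
  have hu : IsUnit (Ideal.Quotient.mk I (AdjoinRoot.root f)) := by
    apply IsUnit.of_mul_eq_one (Ideal.Quotient.mk I y)
    rw [← map_mul, ← map_one (Ideal.Quotient.mk I), Ideal.Quotient.eq, hI]
    simp only [smul_eq_mul, pow_succ] at hy
    linear_combination hy
  obtain ⟨q, hq, hqz⟩ := exists_reversible_of_isUnit (R := R) hu
  refine ⟨n, q, hq, ?_⟩
  have h1 : Ideal.Quotient.mk I (AdjoinRoot.mk f q) = 0 := by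
    rw [← AdjoinRoot.aeval_eq, ← hqz]
    exact (Polynomial.aeval_algHom_apply (Ideal.Quotient.mkₐ R I) (AdjoinRoot.root f) q).symm
  rw [Ideal.Quotient.eq_zero_iff_mem, hI] at h1
  rw [← AdjoinRoot.mk_eq_zero, map_mul, map_pow, AdjoinRoot.mk_X, h1]

/-- Over an artinian ring every linearly recursive bisequence is birecursive. -/
theorem linRecBi_eq_birecBi [IsArtinianRing R] : linRecBi R k = birecBi R k := by
  apply le_antisymm
  · intro w hw j
    obtain ⟨f, hf, hfw⟩ := hw j
    obtain ⟨d, q, hq, hdvd⟩ := exists_dvd_X_pow_mul (R := R) hf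
    refine ⟨q, hq, ?_⟩
    change act _ _ = 0
    have h1 := act_inVar_of_dvd hdvd hfw
    rw [inVar_mul, act_mul] at h1
    funext n
    have h2 := congrFun h1 (n - Pi.single j (d : ℤ))
    rw [act_inVar_X_pow] at h2
    simpa using h2
  · intro w hw j
    obtain ⟨f, hf, hfw⟩ := hw j
    exact ⟨f, hf.1, hfw⟩

theorem isCoprime_X_pow {q : R[X]} (hq : q ∈ reversiblePolys R) (d : ℕ) :
    IsCoprime (X ^ d) q := by
  apply IsCoprime.pow_left
  obtain ⟨a, ha⟩ : X ∣ q - C (q.eval 0) := by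
    rw [X_dvd_iff]; simp [coeff_zero_eq_eval_zero]
  obtain ⟨v, hv⟩ := hq.2.exists_left_inv
  refine ⟨-C v * a, C v, ?_⟩
  have h1 : C v * C (q.eval 0) = (1 : R[X]) := by rw [← C_mul, hv, C_1]
  linear_combination (C v) * ha + h1

theorem act_comm (f g : MvPolynomial (Fin k) R) (w : (Fin k → Z) → R) :
    act f (act g w) = act g (act f w) := by
  rw [← act_mul, mul_comm, act_mul]

theorem act_mem_recAlg {P : Submonoid R[X]} {hP : IsCharClass P} {w : (Fin k → Z) → R}
    (hw : w ∈ recAlg Z k hP) (p : MvPolynomial (Fin k) R) : act p w ∈ recAlg Z k hP := by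
  intro j
  obtain ⟨f, hf, hfw⟩ := hw j
  refine ⟨f, hf, ?_⟩
  change act _ _ = 0
  rw [act_comm, show act (inVar j f) w = 0 from hfw, act_zero_right]

theorem act_sum_right {κ : Type*} (s : Finset κ) (f : MvPolynomial (Fin k) R)
    (w : κ → (Fin k → Z) → R) : act f (∑ i ∈ s, w i) = ∑ i ∈ s, act f (w i) := by
  classical
  induction s using Finset.induction_on with
  | empty => simp
  | insert a s ha ih => rw [Finset.sum_insert ha, Finset.sum_insert ha, act_add_right, ih]

theorem monomial_eq_prod (d : Fin k →₀ ℕ) :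
    MvPolynomial.monomial d (1 : R) = ∏ j, inVar j (X ^ d j) := by
  rw [MvPolynomial.monomial_eq, MvPolynomial.C_1, one_mul, Finsupp.prod_fintype _ _ (by simp)]
  simp [inVar]

theorem act_monomial_of_le {d e : Fin k →₀ ℕ} (h : d ≤ e) {w : (Fin k → Z) → R}
    (hw : act (MvPolynomial.monomial d (1 : R)) w = 0) :
    act (MvPolynomial.monomial e (1 : R)) w = 0 := by
  have : MvPolynomial.monomial e (1 : R) =
      MvPolynomial.monomial (e - d) 1 * MvPolynomial.monomial d 1 := by
    rw [MvPolynomial.monomial_mul, one_mul, tsub_add_cancel_of_le h]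
  rw [this, act_mul, hw, act_zero_right]

theorem isRepresentative_degen [IsArtinianRing R] (k : ℕ) : IsRepresentative (R := R) (G := Fin k → ℕ) (M := degen R k) (degenVal R k) where
  injective := fun u v h => Subtype.ext (Subtype.ext h)
  translate := by
    intro m a
    obtain ⟨m', hm'⟩ := (isRepresentative_recAlg (R := R) isCharClass_monic
      (isExpandable_nat isCharClass_monic) k).translate m.1 a
    refine ⟨⟨m', ?_⟩, hm'⟩
    obtain ⟨d, hd⟩ := m.2
    refine ⟨d, ?_⟩
    have h1 : ((m' : linRec R k) : (Fin k → ℕ) → R) =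
      fun b => ((m : linRec R k) : (Fin k → ℕ) → R) (a + b) := funext hm'
    funext n
    rw [h1, act_translate, hd]
    rfl
  expand := by
    classical
    intro S
    obtain ⟨n, g, e, hge⟩ := (isRepresentative_recAlg (R := R) isCharClass_monic
      (isExpandable_nat isCharClass_monic) k).expand (S.image Subtype.val)
    choose f hf hfe using exists_common (R := R) (k := k) (Z := ℕ) isCharClass_monic
      (Finset.univ.image e)
    choose d q hq hdvd using fun j => exists_dvd_X_pow_mul (R := R) (hf j)
    obtain ⟨d', hd'⟩ : ∃ d' : Fin k →₀ ℕ, ∀ m ∈ S,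
        act (MvPolynomial.monomial d' (1 : R)) (degenVal R k m) = 0 := by
      choose dd hdd using fun m : degen R k => m.2
      exact ⟨S.sup dd, fun m hm => act_monomial_of_le (Finset.le_sup hm) (hdd m)⟩
    let D : Fin k →₀ ℕ := d' + Finsupp.equivFunOnFinite.symm d
    have hDd : ∀ j, d j ≤ D j := fun j => by simp [D]
    have hDS : ∀ m ∈ S, act (MvPolynomial.monomial D (1 : R)) (degenVal R k m) = 0 :=
      fun m hm => act_monomial_of_le (by simp [D]) (hd' m hm)
    choose a b hab using fun j => isCoprime_X_pow (hq j) (D j)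
    let p : MvPolynomial (Fin k) R := ∏ j, inVar j (a j * X ^ D j)
    have hp : p = (∏ j, inVar j (a j)) * MvPolynomial.monomial D 1 := by
      rw [monomial_eq_prod, ← Finset.prod_mul_distrib]
      exact Finset.prod_congr rfl fun j _ => inVar_mul j _ _
    have hmem : ∀ i, act (1 - p) (e i : (Fin k → ℕ) → R) ∈ linRec R k :=
      fun i => act_mem_recAlg (e i).2 _
    have hdeg : ∀ i, (⟨_, hmem i⟩ : linRec R k) ∈ degen R k := by
      intro i
      refine ⟨D, ?_⟩
      change act _ (act _ _) = 0
      rw [← act_mul, ← mem_annihIdeal, ← Ideal.Quotient.eq_zero_iff_mem, mul_sub, mul_one,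
        map_sub, sub_eq_zero, map_mul, monomial_eq_prod, map_prod, map_prod,
        ← Finset.prod_mul_distrib]
      refine Finset.prod_congr rfl fun j _ => ?_
      rw [← map_mul, Ideal.Quotient.eq, ← inVar_mul]
      have h1 : inVar j (X ^ D j) - inVar j (X ^ D j * (a j * X ^ D j)) =
          inVar j (b j * (X ^ D j * q j)) := by
        have : X ^ D j = X ^ D j * (a j * X ^ D j) + b j * (X ^ D j * q j) := by
          linear_combination (-X ^ D j) * hab j
        rw [sub_eq_iff_eq_add', inVar, inVar, inVar, ← map_add, ← this]
      rw [h1, mem_annihIdeal]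
      refine act_inVar_of_dvd (f := f j) ?_ (hfe j _ (Finset.mem_image_of_mem _ (Finset.mem_univ i)))
      exact (hdvd j).trans ((mul_dvd_mul_right (pow_dvd_pow _ (hDd j)) _).trans (dvd_mul_left _ _))
    refine ⟨n, g, fun i => ⟨⟨_, hmem i⟩, hdeg i⟩, fun m hm x y => ?_⟩
    have h1 : (fun b => degenVal R k m (x + b)) =
        ∑ i, degenVal R k m (x + g i) • (e i : (Fin k → ℕ) → R) := by
      funext b
      rw [Finset.sum_apply]
      exact hge m.1 (Finset.mem_image_of_mem _ hm) x b
    have h2 : act p (fun b => degenVal R k m (x + b)) = 0 := by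
      funext b
      rw [act_translate, hp, act_mul, hDS m hm, act_zero_right]
      rfl
    have h3 : act (1 - p) (fun b => degenVal R k m (x + b)) =
        fun b => degenVal R k m (x + b) := by
      rw [act_sub, h2, act_one, sub_zero]
    have h4 := congrFun h3 y
    rw [h1, act_sum_right, Finset.sum_apply] at h4
    refine h4.symm.trans (Finset.sum_congr rfl fun i _ => ?_)
    rw [act_smul_right]
    rfl

/-! ### Bialgebra structures

In each case the comultiplication is dual to the multiplication of `R[x₁, …, x_k]`, respectively of
the Laurent polynomials: `Δ u` is the element of the tensor square representing
`(a, b) ↦ u (a + b)`, and the counit is `u ↦ u 0`. The multiplication is the Hadamard product. -/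

/-- The bialgebra of linearly recursive (birecursive) `k`-sequences, over any ring. -/
instance instBialgebraNat {P : Submonoid R[X]} (hP : IsCharClass P) :
    Bialgebra R (recAlg ℕ k hP) :=
  bialgebraOf (recAlg ℕ k hP).val (isRepresentative_recAlg hP (isExpandable_nat hP) k)

/-- The bialgebra of linearly birecursive `k`-bisequences, over any ring. -/
instance instBialgebraInt : Bialgebra R (birecBi R k) :=
  bialgebraOf (birecBi R k).val (isRepresentative_recAlg isCharClass_reversible isExpandable_int k)

theorem isRepresentative_linRecBi [IsArtinianRing R] (k : ℕ) :
    IsRepresentative (linRecBi R k).val.toLinearMap := by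
  rw [linRecBi_eq_birecBi]
  exact isRepresentative_recAlg isCharClass_reversible isExpandable_int k

/-- The bialgebra of linearly recursive `k`-bisequences over an artinian ring. -/
instance instBialgebraLinRecBi [IsArtinianRing R] : Bialgebra R (linRecBi R k) :=
  bialgebraOf (linRecBi R k).val (isRepresentative_linRecBi k)

/-- The coalgebra of degenerating linearly recursive `k`-sequences over an artinian ring. -/
instance instCoalgebraDegen [IsArtinianRing R] : Coalgebra R (degen R k) :=
  coalgebraOf (R := R) (G := Fin k → ℕ) (M := degen R k) (degenVal R k) (isRepresentative_degen k)

/-! ### Direct sums with the degenerating sequences -/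

/-- The direct sum `D ⊕ C` of the degenerating sequences with an algebra `C` of sequences or
bisequences that is mapped to the linearly recursive sequences by `β`. Module and coalgebra
structure are those of the direct sum. As `D` is an ideal of the linearly recursive sequences
(without unit), the product is
`(d, c) * (d', c') = (d * d' + d * β c' + β c * d', c * c')`, with unit `(0, 1)`. -/
def DegenSum {C : Type*} [CommRing C] [Algebra R C] (_β : C →ₐ[R] linRec R k) : Type _ :=
  degen R k × C

namespace DegenSum

variable {C : Type*} [CommRing C] [Algebra R C] (β : C →ₐ[R] linRec R k)

instance : AddCommGroup (DegenSum β) := inferInstanceAs (AddCommGroup (degen R k × C))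

instance : Module R (DegenSum β) := inferInstanceAs (Module R (degen R k × C))

instance : One (DegenSum β) := ⟨((0 : degen R k), (1 : C))⟩

instance : Mul (DegenSum β) :=
  ⟨fun x y => (⟨x.1 * y.1 + x.1 * β y.2 + β x.2 * y.1,
    (degen R k).add_mem ((degen R k).add_mem ((degen R k).mul_mem_left _ y.1.2)
      ((degen R k).mul_mem_right _ x.1.2)) ((degen R k).mul_mem_left _ y.1.2)⟩, x.2 * y.2)⟩

/-- The pair `(d, c)` as an element of the direct sum. -/
def mk (d : degen R k) (c : C) : DegenSum β := (d, c)

variable {β}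

theorem ext' {x y : DegenSum β} (h1 : (x.1 : linRec R k) = y.1) (h2 : x.2 = y.2) : x = y :=
  Prod.ext (Subtype.ext h1) h2

theorem fst_mul (x y : DegenSum β) :
    ((x * y).1 : linRec R k) = x.1 * y.1 + x.1 * β y.2 + β x.2 * y.1 := rfl

theorem snd_mul (x y : DegenSum β) : (x * y).2 = x.2 * y.2 := rfl

theorem fst_one : ((1 : DegenSum β).1 : linRec R k) = 0 := rfl

theorem snd_one : (1 : DegenSum β).2 = 1 := rfl

theorem fst_add (x y : DegenSum β) : ((x + y).1 : linRec R k) = x.1 + y.1 := rfl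

theorem snd_add (x y : DegenSum β) : (x + y).2 = x.2 + y.2 := rfl

theorem fst_zero : ((0 : DegenSum β).1 : linRec R k) = 0 := rfl

theorem snd_zero : (0 : DegenSum β).2 = 0 := rfl

theorem fst_smul (r : R) (x : DegenSum β) : ((r • x).1 : linRec R k) = r • (x.1 : linRec R k) := rfl

theorem snd_smul (r : R) (x : DegenSum β) : (r • x).2 = r • x.2 := rfl

variable (β)

instance : CommRing (DegenSum β) where
  __ := (inferInstance : AddCommGroup (DegenSum β))
  mul := (· * ·)
  one := 1
  left_distrib x y z := ext' (by simp only [fst_mul, fst_add, snd_add, map_add]; ring)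
    (by simp only [snd_mul, snd_add]; ring)
  right_distrib x y z := ext' (by simp only [fst_mul, fst_add, snd_add, map_add]; ring)
    (by simp only [snd_mul, snd_add]; ring)
  zero_mul x := ext' (by simp only [fst_mul, fst_zero, snd_zero, map_zero]; ring)
    (by simp only [snd_mul, snd_zero]; ring)
  mul_zero x := ext' (by simp only [fst_mul, fst_zero, snd_zero, map_zero]; ring)
    (by simp only [snd_mul, snd_zero]; ring)
  mul_assoc x y z := ext' (by simp only [fst_mul, snd_mul, map_mul]; ring)
    (by simp only [snd_mul]; ring)
  one_mul x := ext' (by simp only [fst_mul, fst_one, snd_one, map_one]; ring)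
    (by simp only [snd_mul, snd_one]; ring)
  mul_one x := ext' (by simp only [fst_mul, fst_one, snd_one, map_one]; ring)
    (by simp only [snd_mul, snd_one]; ring)
  mul_comm x y := ext' (by simp only [fst_mul]; ring) (by simp only [snd_mul]; ring)

instance : Algebra R (DegenSum β) := Algebra.ofModule
  (fun r x y => ext'
    (by simp only [fst_mul, fst_smul, snd_smul, map_smul, smul_add, smul_mul_assoc])
    (by simp only [snd_mul, snd_smul, smul_mul_assoc]))
  (fun r x y => ext'
    (by simp only [fst_mul, fst_smul, snd_smul, map_smul, smul_add, mul_smul_comm])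
    (by simp only [snd_mul, snd_smul, mul_smul_comm]))

instance [IsArtinianRing R] [Coalgebra R C] : Coalgebra R (DegenSum β) :=
  inferInstanceAs (Coalgebra R (degen R k × C))

end DegenSum

/-- The counit and the comultiplication of the algebra and coalgebra `A` are unital algebra
maps, i.e. `A` is a bialgebra. -/
structure IsBialgebra (R A : Type*) [CommRing R] [CommRing A] [Algebra R A] [Coalgebra R A] :
    Prop where
  counit_one : Coalgebra.counit (R := R) (1 : A) = 1
  counit_mul : ∀ x y : A, Coalgebra.counit (R := R) (x * y) =
    Coalgebra.counit (R := R) x * Coalgebra.counit (R := R) y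
  comul_one : Coalgebra.comul (R := R) (1 : A) = 1
  comul_mul : ∀ x y : A, Coalgebra.comul (R := R) (x * y) =
    Coalgebra.comul (R := R) x * Coalgebra.comul (R := R) y

/-- `w` is obtained from `u` by backsolving: for some polynomials `x_j ^ d_j * q_j(x_j)`
annihilating `u`, with `q_j` reversible, the bisequence `w` is annihilated by all `q_j(x_j)` and
agrees with `u` at all `n ≥ d`. -/
def IsBacksolution (u : (Fin k → ℕ) → R) (w : (Fin k → ℤ) → R) : Prop :=
  ∃ (d : Fin k → ℕ) (q : Fin k → R[X]),
    (∀ j, q j ∈ reversiblePolys R ∧ inVar j (X ^ d j * q j) ∈ annih u ∧ inVar j (q j) ∈ annih w) ∧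
    ∀ n, d ≤ n → restr w n = u n

end Recursive

end RecSeq

end

noncomputable section

namespace RecSeq

/-! ### Restriction and extension of birecursive sequences -/

section Extension

open Polynomial

variable {R : Type*} [CommRing R] {k : ℕ}

/-! Everything rests on one observation: if a reversible `q(x_j)` annihilates `v`, then `x_j` is a
unit in the quotient of `R[x₁, …, x_k]` by the annihilator of `v`, because `X` and `q` are coprime
(`isUnit_mk_inVar_X`). That quotient acts on `v`, so negative powers of the variables act on `v` as
well. A birecursive sequence `v` therefore extends to `ℤ ^ k` by `w(n) = (x^n ⇀ v)(0)`, with the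
same annihilator (`exists_restr_eq`). A birecursive bisequence that vanishes on some orthant `n ≥ d`
vanishes, since it is recovered from its shift by a large monomial (`eq_zero_of_restr_eq_zero`).

The artinian hypothesis enters through `exists_dvd_X_pow_mul`: every monic `f` divides some `X ^ d *
q` with `q` reversible. Hence a recursive bisequence is birecursive, as shifts are invertible on `ℤ
^ k`, and a recursive sequence `u` becomes birecursive after a shift by some `d`. Extending the
shifted sequence and shifting back gives a birecursive bisequence that agrees with `u` far out, and
there is only one. This is `γ u`. Uniqueness yields the algebra laws for `γ`, the identity `γ ∘ β =
id` and the kernel `D`; hence `L` is the direct sum of the ideal `D` and the image of `β`.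

On the coalgebra side, `Δ m` is determined by the function `(a, b) ↦ m (a + b)`, so any linear map
given by composition with an additive map respects `Δ` (`map_comulOf`). This covers the restrictions
and inclusions. The map `γ` is not of this kind and in general does not preserve the counit; its
compatibility with `Δ` follows from the decomposition `u = (u - βγu) + βγu` into two coalgebra
images. Finally `(d, c) ↦ d + β c` is a bijective algebra map from `D ⊕ C` to `L` that respects the
coalgebra structures, so the bialgebra axioms pass from `L` to `D ⊕ C`. -/

/-- Makes the action of the quotient by the annihilator on `v` well defined, so that inverses of the
variables in that quotient can be applied to `v` through any representative. -/
theorem act_eq_of_mk_eq {Z : Type*} [CommSemiring Z] {v : (Fin k → Z) → R}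
    {p p' : MvPolynomial (Fin k) R}
    (h : Ideal.Quotient.mk (annihIdeal v) p = Ideal.Quotient.mk (annihIdeal v) p') :
    act p v = act p' v := by
  rw [Ideal.Quotient.eq, mem_annihIdeal, act_sub, sub_eq_zero] at h
  exact h

/-- A Bézout relation `a * X + b * q = 1` becomes `a * X = 1` modulo the annihilator, since `q(x_j)`
is zero there. -/
theorem isUnit_mk_inVar_X {Z : Type*} [CommSemiring Z] {v : (Fin k → Z) → R} {j : Fin k}
    {q : R[X]} (hq : q ∈ reversiblePolys R) (hqv : act (inVar j q) v = 0) :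
    IsUnit (Ideal.Quotient.mk (annihIdeal v) (inVar j X)) := by
  obtain ⟨a, b, hab⟩ := isCoprime_X_pow hq 1
  apply IsUnit.of_mul_eq_one (Ideal.Quotient.mk (annihIdeal v) (inVar j a))
  have h1 : Ideal.Quotient.mk (annihIdeal v) (inVar j q) = 0 :=
    Ideal.Quotient.eq_zero_iff_mem.mpr hqv
  have h2 : inVar j (a * X ^ 1 + b * q) = inVar j a * inVar j X + inVar j b * inVar j q := by
    simp [inVar]
  have h3 := congrArg (fun p => Ideal.Quotient.mk (annihIdeal v) (inVar j p)) hab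
  simp only [h2, map_add, map_mul, h1, mul_zero, add_zero] at h3
  rw [mul_comm, h3]
  simp [inVar]

/-- A birecursive sequence extends to a bisequence with the same annihilator. -/
theorem exists_restr_eq {v : (Fin k → ℕ) → R} (hv : v ∈ birec R k) :
    ∃ w : (Fin k → ℤ) → R, restr w = v ∧ annih w = annih v := by
  choose q hq hqv using hv
  let U : Fin k → (MvPolynomial (Fin k) R ⧸ annihIdeal v)ˣ :=
    fun j => (isUnit_mk_inVar_X (hq j) (hqv j)).unit
  -- `p n` is a polynomial representing the Laurent monomial `x^n` in the quotient, also for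
  -- negative exponents.
  choose p hp using fun n : Fin k → ℤ =>
    Ideal.Quotient.mk_surjective (I := annihIdeal v) (↑(∏ j, U j ^ n j))
  let w : (Fin k → ℤ) → R := fun n => act (p n) v 0
  have hmon : ∀ d : Fin k →₀ ℕ, Ideal.Quotient.mk (annihIdeal v) (MvPolynomial.monomial d 1) =
      ↑(∏ j, U j ^ (d j : ℤ)) := by
    intro d
    rw [monomial_eq_prod, map_prod, Units.coe_prod]
    refine Finset.prod_congr rfl fun j _ => ?_
    rw [zpow_natCast, Units.val_pow_eq_pow_val, IsUnit.unit_spec, ← map_pow]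
    simp [inVar]
  -- The action on `w` is the action on `v` of a multiple of `f`; this gives the inclusion of the
  -- annihilator of `v` in that of `w`. The other inclusion comes from restriction.
  have key : ∀ f n, act f w n = act (f * p n) v 0 := by
    intro f n
    induction f using MvPolynomial.induction_on' with
    | add f g hf hg => rw [add_mul, act_add, act_add, Pi.add_apply, Pi.add_apply, hf, hg]
    | monomial d a =>
      have h1 : MvPolynomial.monomial d a =
          MvPolynomial.monomial 0 a * MvPolynomial.monomial d 1 := by
        rw [MvPolynomial.monomial_mul, zero_add, mul_one]
      have h2 : act (MvPolynomial.monomial d 1 * p n) v = act (p (n + expo ℤ d)) v := by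
        apply act_eq_of_mk_eq
        rw [map_mul, hmon, hp, hp, ← Units.val_mul, ← Finset.prod_mul_distrib]
        congr 1
        refine Finset.prod_congr rfl fun j _ => ?_
        rw [Pi.add_apply, expo_apply, zpow_add]
        exact mul_comm (U j ^ (d j : ℤ)) (U j ^ n j)
      rw [act_monomial, h1, mul_assoc, act_mul, act_monomial, h2]
      simp [w]
  have hres : restr w = v := by
    funext n
    let d : Fin k →₀ ℕ := Finsupp.equivFunOnFinite.symm n
    have h1 : act (p fun j => (n j : ℤ)) v = act (MvPolynomial.monomial d 1) v := by
      apply act_eq_of_mk_eq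
      rw [hp, hmon]
      rfl
    change act (p fun j => (n j : ℤ)) v 0 = v n
    rw [h1, act_monomial, one_mul, zero_add]
    rfl
  refine ⟨w, hres, Set.ext fun f => ⟨fun hf => ?_, fun hf => ?_⟩⟩
  · change act f v = 0
    rw [← hres, act_restr, show act f w = 0 from hf]
    rfl
  · change act f w = 0
    funext n
    rw [key, mul_comm, act_mul, show act f v = 0 from hf, act_zero_right]
    rfl

/-- A birecursive bisequence that vanishes far out vanishes. -/
theorem eq_zero_of_restr_eq_zero {w : (Fin k → ℤ) → R} (hw : w ∈ birecBi R k) {d : Fin k → ℕ}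
    (h : ∀ n, d ≤ n → restr w n = 0) : w = 0 := by
  choose q hq hqw using hw
  funext n
  -- The shift `d j + |n j|` moves `n`, and every `n + i` with `i ≥ 0`, into the orthant `≥ d` where
  -- `w` vanishes.
  let N : Fin k →₀ ℕ := Finsupp.equivFunOnFinite.symm fun j => d j + (n j).natAbs
  have hu : IsUnit (Ideal.Quotient.mk (annihIdeal w) (MvPolynomial.monomial N 1)) := by
    have h1 := fun j => (isUnit_mk_inVar_X (hq j) (hqw j)).pow (N j)
    rw [monomial_eq_prod, map_prod]
    have h2 : ∀ j, inVar j (X ^ N j) = (inVar j X : MvPolynomial (Fin k) R) ^ N j := fun j => by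
      simp [inVar]
    simp only [h2, map_pow]
    rw [IsUnit.prod_iff]
    exact fun j _ => h1 j
  obtain ⟨y, hy⟩ := hu.exists_left_inv
  obtain ⟨p, rfl⟩ := Ideal.Quotient.mk_surjective y
  rw [← map_mul, ← map_one (Ideal.Quotient.mk (annihIdeal w))] at hy
  -- With `p` inverse to `x^N` modulo the annihilator, `w = p ⇀ (x^N ⇀ w)`, so `w n` is a
  -- combination of the values `w (n + i + N)`.
  rw [← act_one w, ← act_eq_of_mk_eq hy, act_mul]
  refine Finset.sum_eq_zero fun i _ => ?_
  rw [act_monomial, one_mul]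
  have h3 : n + expo ℤ i + expo ℤ N =
      fun j => ((n j + i j + d j + (n j).natAbs).toNat : ℤ) := by
    funext j
    simp only [Pi.add_apply, expo_apply, N, Finsupp.equivFunOnFinite_symm_apply_apply]
    omega
  have h4 := h (fun j => (n j + i j + d j + (n j).natAbs).toNat) fun j => by
    simp only []
    omega
  rw [h3, show w _ = 0 from h4, mul_zero]

theorem restr_add (v w : (Fin k → ℤ) → R) : restr (v + w) = restr v + restr w := rfl

theorem restr_sub (v w : (Fin k → ℤ) → R) : restr (v - w) = restr v - restr w := rfl

theorem restr_mul (v w : (Fin k → ℤ) → R) : restr (v * w) = restr v * restr w := rfl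

theorem eq_of_restr_eq {w w' : (Fin k → ℤ) → R} (hw : w ∈ birecBi R k) (hw' : w' ∈ birecBi R k)
    {d : Fin k → ℕ} (h : ∀ n, d ≤ n → restr w n = restr w' n) : w = w' :=
  sub_eq_zero.mp <| eq_zero_of_restr_eq_zero (sub_mem hw hw') (d := d) fun n hn => by
    rw [restr_sub, Pi.sub_apply, h n hn, sub_self]

theorem mem_degen_iff {u : linRec R k} :
    u ∈ degen R k ↔ ∃ d : Fin k → ℕ, ∀ n, d ≤ n → (u : (Fin k → ℕ) → R) n = 0 := by
  constructor
  · rintro ⟨d, hd⟩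
    refine ⟨d, fun n hn => ?_⟩
    have h1 := congrFun hd (n - d)
    rw [act_monomial, one_mul] at h1
    have h2 : n - ⇑d + expo ℕ d = n := by
      funext j
      have : d j ≤ n j := hn j
      simp only [Pi.add_apply, Pi.sub_apply, expo_apply, Nat.cast_id]
      omega
    rwa [h2] at h1
  · rintro ⟨d, hd⟩
    refine ⟨Finsupp.equivFunOnFinite.symm d, funext fun n => ?_⟩
    rw [act_monomial, one_mul]
    exact hd _ fun j => by simp

end Extension

/-! ### Backsolving -/

section Backsolving

open Polynomial

variable {R : Type*} [CommRing R] [IsArtinianRing R] {k : ℕ}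

/-- Being recursive or birecursive depends only on the annihilator, which the extension of
`exists_restr_eq` preserves. Conversely the reverse of a reversible sequence is birecursive by
`linRecBi_eq_birecBi`, and its annihilator is that of the sequence. -/
theorem birec_eq_reversibleSeqs :
    (birec R k : Set ((Fin k → ℕ) → R)) = reversibleSeqs R k := by
  ext u
  constructor
  · intro hu
    obtain ⟨w, hw, han⟩ := exists_restr_eq hu
    refine ⟨birec_le_linRec hu, w, ?_, hw, han⟩
    have h1 : ContainsElementary (monicPolys R) (annih u) := birec_le_linRec hu
    rw [← han] at h1
    exact h1
  · rintro ⟨_, w, hw, _, han⟩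
    rw [linRecBi_eq_birecBi] at hw
    have h1 : ContainsElementary (reversiblePolys R) (annih w) := hw
    rw [han] at h1
    exact h1

/-- Frees backsolving from the choice of polynomials. The definition asks for the same `q j` on both
sides; this is arranged by multiplying a reversible part of the recursion of `u` with a reversible
polynomial annihilating `w`. -/
theorem isBacksolution_iff {u : (Fin k → ℕ) → R} (hu : u ∈ linRec R k) {w : (Fin k → ℤ) → R} :
    IsBacksolution u w ↔
      w ∈ birecBi R k ∧ ∃ d : Fin k → ℕ, ∀ n, d ≤ n → restr w n = u n := by
  constructor
  · rintro ⟨d, q, hq, h⟩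
    exact ⟨fun j => ⟨q j, (hq j).1, (hq j).2.2⟩, d, h⟩
  · rintro ⟨hw, d, h⟩
    choose f hf hfu using hu
    choose e q hq hdvd using fun j => exists_dvd_X_pow_mul (hf j)
    choose g hg hgw using hw
    -- `e` is needed for the factor `X ^ e j` in the recursion of `u`, and `d` for the agreement
    -- with `w`; their sum serves for both.
    refine ⟨d + e, fun j => q j * g j, fun j => ⟨Submonoid.mul_mem _ (hq j) (hg j), ?_, ?_⟩,
      fun n hn => h n (le_trans (by simp) hn)⟩
    · refine act_inVar_of_dvd ((hdvd j).trans ?_) (hfu j)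
      exact mul_dvd_mul (pow_dvd_pow _ (by simp)) (dvd_mul_right _ _)
    · exact act_inVar_of_dvd (dvd_mul_left _ _) (hgw j)

/-- Shifting `u` by `d` absorbs the factors `X ^ d j` of its recursions `X ^ d j * q j`, leaving a
birecursive sequence. Its extension to `ℤ ^ k` is then shifted back by `d`. -/
theorem exists_backsolution {u : (Fin k → ℕ) → R} (hu : u ∈ linRec R k) :
    ∃ w ∈ birecBi R k, ∃ d : Fin k → ℕ, ∀ n, d ≤ n → restr w n = u n := by
  choose f hf hfu using hu
  choose d q hq hdvd using fun j => exists_dvd_X_pow_mul (hf j)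
  let D : Fin k →₀ ℕ := Finsupp.equivFunOnFinite.symm d
  have hv : act (MvPolynomial.monomial D (1 : R)) u ∈ birec R k := by
    intro j
    refine ⟨q j, hq j, ?_⟩
    have h1 : MvPolynomial.monomial D (1 : R) =
        (∏ i ∈ Finset.univ.erase j, inVar i (X ^ d i)) * inVar j (X ^ d j) := by
      rw [monomial_eq_prod, Finset.prod_erase_mul _ _ (Finset.mem_univ j)]
      rfl
    change act _ _ = 0
    rw [← act_mul, h1, mul_left_comm, act_mul, mul_comm, ← inVar_mul,
      act_inVar_of_dvd (hdvd j) (hfu j), act_zero_right]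
  obtain ⟨w, hw, han⟩ := exists_restr_eq hv
  have hwb : ContainsElementary (reversiblePolys R) (annih w) := by rw [han]; exact hv
  -- Translation by `-d` keeps the annihilating polynomials. Agreement with `u` is obtained only for
  -- `n ≥ d`, since the shifted sequence retains no other values of `u`.
  refine ⟨fun n => w (-expo ℤ D + n), fun j => ?_, d, fun n hn => ?_⟩
  · obtain ⟨g, hg, hgw⟩ := hwb j
    refine ⟨g, hg, funext fun n => ?_⟩
    rw [act_translate, show act (inVar j g) w = 0 from hgw]
    rfl
  · have h1 := congrFun hw (n - d)
    rw [act_monomial, one_mul] at h1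
    have h2 : n - d + expo ℕ D = n := by
      funext j
      have : d j ≤ n j := hn j
      simp only [Pi.add_apply, Pi.sub_apply, expo_apply, Nat.cast_id, D,
        Finsupp.equivFunOnFinite_symm_apply_apply]
      omega
    rw [h2] at h1
    rw [← h1]
    change w _ = w _
    congr 1
    funext j
    have : d j ≤ n j := hn j
    simp only [Pi.add_apply, Pi.sub_apply, Pi.neg_apply, expo_apply, D,
        Finsupp.equivFunOnFinite_symm_apply_apply]
    omega

/-- The backsolution of a linearly recursive sequence. -/
def backsol (u : linRec R k) : (Fin k → ℤ) → R := (exists_backsolution u.2).choose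

theorem backsol_mem (u : linRec R k) : backsol u ∈ birecBi R k :=
  (exists_backsolution u.2).choose_spec.1

theorem exists_restr_backsol (u : linRec R k) :
    ∃ d : Fin k → ℕ, ∀ n, d ≤ n → restr (backsol u) n = (u : (Fin k → ℕ) → R) n :=
  (exists_backsolution u.2).choose_spec.2

theorem eq_backsol {u : linRec R k} {w : (Fin k → ℤ) → R} (hw : w ∈ birecBi R k) {d : Fin k → ℕ}
    (h : ∀ n, d ≤ n → restr w n = (u : (Fin k → ℕ) → R) n) : w = backsol u := by
  obtain ⟨e, he⟩ := exists_restr_backsol u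
  exact eq_of_restr_eq hw (backsol_mem u) (d := d + e) fun n hn => by
    rw [h n (le_trans (by simp) hn), he n (le_trans (by simp) hn)]

theorem isBacksolution_iff_eq_backsol (u : linRec R k) (w : (Fin k → ℤ) → R) :
    IsBacksolution (u : (Fin k → ℕ) → R) w ↔ w = backsol u := by
  rw [isBacksolution_iff u.2]
  constructor
  · rintro ⟨hw, d, h⟩
    exact eq_backsol hw h
  · rintro rfl
    exact ⟨backsol_mem u, exists_restr_backsol u⟩

/-- Backsolving, as an algebra map. -/
def backsolve (R : Type*) [CommRing R] [IsArtinianRing R] (k : ℕ) :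
    linRec R k →ₐ[R] linRecBi R k :=
  AlgHom.ofLinearMap
    { toFun := fun u => ⟨backsol u, linRecBi_eq_birecBi (R := R) ▸ backsol_mem u⟩
      -- Each algebra law is an instance of uniqueness: the sum, multiple or product of
      -- backsolutions is birecursive and agrees far out with the corresponding sequence.
      map_add' := fun u v => Subtype.ext <| by
        obtain ⟨d, hd⟩ := exists_restr_backsol u
        obtain ⟨e, he⟩ := exists_restr_backsol v
        refine (eq_backsol (add_mem (backsol_mem u) (backsol_mem v)) (d := d + e)
          fun n hn => ?_).symm
        rw [restr_add, Pi.add_apply, hd n (le_trans (by simp) hn), he n (le_trans (by simp) hn)]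
        rfl
      map_smul' := fun r u => Subtype.ext <| by
        obtain ⟨d, hd⟩ := exists_restr_backsol u
        refine (eq_backsol (Subalgebra.smul_mem _ (backsol_mem u) r) (d := d) fun n hn => ?_).symm
        change r • restr (backsol u) n = _
        rw [hd n hn]
        rfl }
    (Subtype.ext (eq_backsol (one_mem _) (d := 0) fun _ _ => rfl).symm)
    (fun u v => Subtype.ext <| by
      obtain ⟨d, hd⟩ := exists_restr_backsol u
      obtain ⟨e, he⟩ := exists_restr_backsol v
      refine (eq_backsol (mul_mem (backsol_mem u) (backsol_mem v)) (d := d + e)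
        fun n hn => ?_).symm
      rw [restr_mul, Pi.mul_apply, hd n (le_trans (by simp) hn), he n (le_trans (by simp) hn)]
      rfl)

theorem mem_birecBi (w : linRecBi R k) : (w : (Fin k → ℤ) → R) ∈ birecBi R k :=
  linRecBi_eq_birecBi (R := R) ▸ w.2

theorem backsolve_restr (w : linRecBi R k) : backsolve R k (linRecBiRestr R k w) = w :=
  Subtype.ext (eq_backsol (u := linRecBiRestr R k w) (mem_birecBi w) (d := 0) fun _ _ => rfl).symm

theorem sub_restr_backsolve_mem_degen (u : linRec R k) :
    u - linRecBiRestr R k (backsolve R k u) ∈ degen R k := by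
  obtain ⟨d, hd⟩ := exists_restr_backsol u
  exact mem_degen_iff.mpr ⟨d, fun n hn => sub_eq_zero.mpr (hd n hn).symm⟩

/-- A degenerating sequence is one that vanishes far out, that is, one that has the zero bisequence
as backsolution. -/
theorem backsolve_eq_zero_iff {u : linRec R k} : backsolve R k u = 0 ↔ u ∈ degen R k := by
  constructor
  · intro h
    simpa [h] using sub_restr_backsolve_mem_degen u
  · intro h
    obtain ⟨d, hd⟩ := mem_degen_iff.mp h
    exact Subtype.ext (eq_backsol (zero_mem _) (d := d) fun n hn => (hd n hn).symm).symm

end Backsolving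

end RecSeq

end
noncomputable section

namespace RecSeq

/-! ### Coalgebra maps between spaces of functions -/

section CoalgebraMaps

variable {R : Type*} [CommRing R] {G H : Type*} [AddCommMonoid G] [AddCommMonoid H]
  {M N : Type*} [AddCommGroup M] [Module R M] [AddCommGroup N] [Module R N]

theorem toFun₂_map {ι : M →ₗ[R] (G → R)} {κ : N →ₗ[R] (H → R)} {f : M →ₗ[R] N} {φ : H →+ G}
    (hf : ∀ m a, κ (f m) a = ι m (φ a)) (t : M ⊗[R] M) (a b : H) :
    toFun₂ κ (TensorProduct.map f f t) a b = toFun₂ ι t (φ a) (φ b) := by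
  induction t with
  | zero => simp
  | tmul x y => simp [hf]
  | add x y hx hy => simp only [map_add, Pi.add_apply, hx, hy]

/-- A linear map that is composition with an additive map is compatible with comultiplication. -/
theorem map_comulOf {ι : M →ₗ[R] (G → R)} (hι : IsRepresentative ι) {κ : N →ₗ[R] (H → R)}
    (hκ : IsRepresentative κ) {f : M →ₗ[R] N} {φ : H →+ G}
    (hf : ∀ m a, κ (f m) a = ι m (φ a)) (m : M) :
    TensorProduct.map f f (comulOf ι hι m) = comulOf κ hκ (f m) := by
  -- Both sides represent the function `(a, b) ↦ m (φ a + φ b) = m (φ (a + b))`, and elements of the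
  -- tensor square are determined by their functions.
  apply hκ.toFun₂_injective
  funext a b
  rw [toFun₂_map hf, toFun₂_comulOf, toFun₂_comulOf, hf, map_add]

end CoalgebraMaps

/-! ### Compatibility of restriction, inclusion and backsolving with the coalgebra structures -/

section CompatibleMaps

variable {R : Type*} [CommRing R] {k : ℕ}

/-- The inclusion of `ℕ ^ k` in `ℤ ^ k`. -/
def castVec (k : ℕ) : (Fin k → ℕ) →+ (Fin k → ℤ) where
  toFun n j := n j
  map_zero' := by funext j; simp
  map_add' m n := by funext j; simp

/-- `f` is compatible with the counits and the comultiplications. -/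
structure IsCoalgMap {M N : Type*} [AddCommMonoid M] [Module R M] [AddCommMonoid N] [Module R N]
    [Coalgebra R M] [Coalgebra R N] (f : M →ₗ[R] N) : Prop where
  counit : ∀ m, Coalgebra.counit (R := R) (f m) = Coalgebra.counit (R := R) m
  comul : ∀ m, TensorProduct.map f f (Coalgebra.comul (R := R) m) =
    Coalgebra.comul (R := R) (f m)

theorem isCoalgMap_birecIncl : IsCoalgMap (birecIncl R k).toLinearMap where
  counit _ := rfl
  comul := map_comulOf _ _ (φ := AddMonoidHom.id _) fun _ _ => rfl

theorem isCoalgMap_birecBiRestr : IsCoalgMap (birecBiRestr R k).toLinearMap where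
  counit _ := rfl
  comul := map_comulOf _ _ (φ := castVec k) fun _ _ => rfl

variable [IsArtinianRing R]

theorem isCoalgMap_linRecBiRestr : IsCoalgMap (linRecBiRestr R k).toLinearMap where
  counit _ := rfl
  comul := map_comulOf _ _ (φ := castVec k) fun _ _ => rfl

/-- The inclusion of the degenerating sequences in the linearly recursive ones. -/
def degenIncl (R : Type*) [CommRing R] (k : ℕ) : degen R k →ₗ[R] linRec R k where
  toFun d := d
  map_add' _ _ := rfl
  map_smul' _ _ := rfl

theorem isCoalgMap_degenIncl : IsCoalgMap (degenIncl R k) where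
  counit _ := rfl
  comul := map_comulOf _ _ (φ := AddMonoidHom.id _) fun _ _ => rfl

/-- Backsolving is not composition with an additive map, so `map_comulOf` does not apply. Instead `u
= d + β (γ u)` with `d` degenerating. As `D` is a subcoalgebra killed by `γ`, the first summand
contributes nothing to `(γ ⊗ γ) (Δ u)`; as `γ ∘ β = id`, the second contributes `Δ (γ u)`. -/
theorem comul_backsolve (u : linRec R k) : Coalgebra.comul (R := R) (backsolve R k u) =
    TensorProduct.map (backsolve R k).toLinearMap (backsolve R k).toLinearMap
      (Coalgebra.comul (R := R) u) := by
  let γ := (backsolve R k).toLinearMap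
  let β := (linRecBiRestr R k).toLinearMap
  have h1 : γ ∘ₗ β = LinearMap.id := LinearMap.ext backsolve_restr
  have h2 : γ ∘ₗ degenIncl R k = 0 := LinearMap.ext fun d => backsolve_eq_zero_iff.mpr d.2
  have h3 : u = degenIncl R k ⟨_, sub_restr_backsolve_mem_degen u⟩ + β (γ u) :=
    (sub_add_cancel _ _).symm
  change _ = TensorProduct.map γ γ _
  conv_rhs => rw [h3]
  rw [map_add, map_add, ← isCoalgMap_degenIncl.comul, ← isCoalgMap_linRecBiRestr.comul,
    TensorProduct.map_map, TensorProduct.map_map, h1, h2, TensorProduct.map_id, TensorProduct.map_zero_left]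
  simp [γ]

end CompatibleMaps

/-! ### The direct sums as bialgebras -/

namespace DegenSum

variable {R : Type*} [CommRing R] {k : ℕ} {C : Type*} [CommRing C] [Algebra R C]
  (β : C →ₐ[R] linRec R k)

/-- The algebra map `(d, c) ↦ d + β c`. -/
def toLinRec : DegenSum β →ₐ[R] linRec R k :=
  AlgHom.ofLinearMap
    { toFun := fun x => x.1 + β x.2
      map_add' := fun x y => by rw [fst_add, snd_add, map_add]; ring
      map_smul' := fun r x => by rw [fst_smul, snd_smul, map_smul, smul_add]; rfl }
    (by
      change ((1 : DegenSum β).1 : linRec R k) + β (1 : DegenSum β).2 = 1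
      rw [fst_one, snd_one, map_one, zero_add])
    (fun x y => by
      change ((x * y).1 : linRec R k) + β (x * y).2 = (x.1 + β x.2) * (y.1 + β y.2)
      rw [fst_mul, snd_mul, map_mul]
      ring)

theorem toLinRec_apply (x : DegenSum β) : toLinRec β x = x.1 + β x.2 := rfl

/-- The hypotheses say that `β` is injective with image a complement of `D`; since `0 ∈ D`, `hinj`
covers both injectivity and trivial intersection. -/
theorem toLinRec_bijective (hinj : ∀ c, β c ∈ degen R k → c = 0)
    (hsurj : ∀ u, ∃ c, u - β c ∈ degen R k) : Function.Bijective (toLinRec β) := by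
  constructor
  · rw [injective_iff_map_eq_zero]
    intro x hx
    rw [toLinRec_apply] at hx
    have h1 : x.2 = 0 := hinj _ <| by
      rw [eq_neg_of_add_eq_zero_right hx]
      exact neg_mem x.1.2
    rw [h1, map_zero, add_zero] at hx
    exact ext' hx h1
  · intro u
    obtain ⟨c, hc⟩ := hsurj u
    exact ⟨mk β ⟨_, hc⟩ c, sub_add_cancel _ _⟩

variable [IsArtinianRing R] [Coalgebra R C] {β}

theorem isCoalgMap_toLinRec (hβ : IsCoalgMap β.toLinearMap) :
    IsCoalgMap (toLinRec β).toLinearMap where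
  counit x := by
    change Coalgebra.counit (R := R) (degenIncl R k x.1 + β.toLinearMap x.2) =
      Coalgebra.counit (R := R) x.1 + Coalgebra.counit (R := R) x.2
    rw [map_add, isCoalgMap_degenIncl.counit, hβ.counit]
  comul x := by
    -- The comultiplication of the direct sum is the sum of those of the summands pushed forward
    -- along the two injections, so the claim can be checked on each summand.
    let inl : degen R k →ₗ[R] DegenSum β := LinearMap.inl R (degen R k) C
    let inr : C →ₗ[R] DegenSum β := LinearMap.inr R (degen R k) C
    have hl : (toLinRec β).toLinearMap ∘ₗ inl = degenIncl R k := by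
      ext1 d
      change (d : linRec R k) + β 0 = d
      rw [map_zero, add_zero]
    have hr : (toLinRec β).toLinearMap ∘ₗ inr = β.toLinearMap := by
      ext1 c
      exact zero_add _
    change TensorProduct.map _ _ (TensorProduct.map inl inl (Coalgebra.comul (R := R) x.1) +
      TensorProduct.map inr inr (Coalgebra.comul (R := R) x.2)) =
        Coalgebra.comul (R := R) (degenIncl R k x.1 + β.toLinearMap x.2)
    rw [map_add, map_add, TensorProduct.map_map, TensorProduct.map_map, hl, hr, isCoalgMap_degenIncl.comul,
      hβ.comul]

/-- Transport of structure: an algebra isomorphism onto the bialgebra `L` that respects counit and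
comultiplication carries the bialgebra identities back to `D ⊕ C`. -/
theorem isBialgebra (hβ : IsCoalgMap β.toLinearMap) (hb : Function.Bijective (toLinRec β)) :
    IsBialgebra R (DegenSum β) := by
  let e := AlgEquiv.ofBijective (toLinRec β) hb
  have hσ := isCoalgMap_toLinRec hβ
  have hc : ∀ x, Coalgebra.counit (R := R) (toLinRec β x) = Coalgebra.counit (R := R) x :=
    hσ.counit
  have hm : ∀ x, Algebra.TensorProduct.congr e e (Coalgebra.comul (R := R) x) =
    Coalgebra.comul (R := R) (toLinRec β x) := hσ.comul
  refine ⟨?_, fun x y => ?_, ?_, fun x y => ?_⟩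
  · rw [← hc, map_one, Bialgebra.counit_one]
  · rw [← hc, map_mul, Bialgebra.counit_mul, hc, hc]
  · apply (Algebra.TensorProduct.congr e e).injective
    rw [hm, map_one (toLinRec β), map_one (Algebra.TensorProduct.congr e e), Bialgebra.comul_one]
  · apply (Algebra.TensorProduct.congr e e).injective
    rw [hm, map_mul (toLinRec β), map_mul (Algebra.TensorProduct.congr e e), Bialgebra.comul_mul, hm, hm]

/-- The isomorphism `(d, c) ↦ d + β c`. -/
def equivLinRec (hβ : IsCoalgMap β.toLinearMap) (hb : Function.Bijective (toLinRec β)) :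
    DegenSum β ≃ₐc[R] linRec R k where
  __ := AlgEquiv.ofBijective (toLinRec β) hb
  map_smul' := map_smul (toLinRec β)
  counit_comp := LinearMap.ext (isCoalgMap_toLinRec hβ).counit
  map_comp_comul := LinearMap.ext (isCoalgMap_toLinRec hβ).comul

/-- Identifies the inverse from a decomposition of `u`, which gives the explicit formulas for the
isomorphisms. -/
theorem equivLinRec_symm_eq (hβ : IsCoalgMap β.toLinearMap)
    (hb : Function.Bijective (toLinRec β)) {u : linRec R k} {x : DegenSum β}
    (h : (x.1 : linRec R k) + β x.2 = u) : (equivLinRec hβ hb).symm u = x := by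
  rw [← h]
  exact (equivLinRec hβ hb).symm_apply_apply x

/-- The isomorphism between the direct sums of two algebras that both complement the degenerating
sequences. -/
def equivDegenSum {C' : Type*} [CommRing C'] [Algebra R C'] [Coalgebra R C']
    {β' : C' →ₐ[R] linRec R k} (hβ : IsCoalgMap β.toLinearMap)
    (hb : Function.Bijective (toLinRec β)) (hβ' : IsCoalgMap β'.toLinearMap)
    (hb' : Function.Bijective (toLinRec β')) : DegenSum β ≃ₐc[R] DegenSum β' :=
  (equivLinRec hβ hb).trans (equivLinRec hβ' hb').symm

theorem equivDegenSum_apply {C' : Type*} [CommRing C'] [Algebra R C'] [Coalgebra R C']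
    {β' : C' →ₐ[R] linRec R k} (hβ : IsCoalgMap β.toLinearMap)
    (hb : Function.Bijective (toLinRec β)) (hβ' : IsCoalgMap β'.toLinearMap)
    (hb' : Function.Bijective (toLinRec β')) {x : DegenSum β} {c : C'} (h : β' c = β x.2) :
    equivDegenSum hβ hb hβ' hb' x = mk β' x.1 c :=
  equivLinRec_symm_eq hβ' hb' (x := mk β' x.1 c) (congrArg ((x.1 : linRec R k) + ·) h)

end DegenSum

/-! ### The complements of the degenerating sequences -/

section Bijectivity

variable {R : Type*} [CommRing R] [IsArtinianRing R] {k : ℕ}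

theorem toLinRec_linRecBiRestr_bijective :
    Function.Bijective (DegenSum.toLinRec (linRecBiRestr R k)) :=
  DegenSum.toLinRec_bijective _
    (fun w hw => by rw [← backsolve_restr w, backsolve_eq_zero_iff.mpr hw])
    (fun u => ⟨_, sub_restr_backsolve_mem_degen u⟩)

theorem toLinRec_birecBiRestr_bijective :
    Function.Bijective (DegenSum.toLinRec (birecBiRestr R k)) := by
  refine DegenSum.toLinRec_bijective _ (fun w hw => ?_)
    (fun u => ⟨⟨backsol u, backsol_mem u⟩, sub_restr_backsolve_mem_degen u⟩)
  obtain ⟨d, hd⟩ := mem_degen_iff.mp hw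
  exact Subtype.ext (eq_zero_of_restr_eq_zero w.2 hd)

theorem toLinRec_birecIncl_bijective :
    Function.Bijective (DegenSum.toLinRec (birecIncl R k)) := by
  refine DegenSum.toLinRec_bijective _ (fun v hv => ?_)
    (fun u => ⟨restrict isCharClass_reversible k ⟨backsol u, backsol_mem u⟩,
      sub_restr_backsolve_mem_degen u⟩)
  obtain ⟨d, hd⟩ := mem_degen_iff.mp hv
  -- A birecursive sequence that vanishes far out is zero, because this holds for its extension to
  -- `ℤ ^ k`, which is birecursive by the equality of annihilators.
  obtain ⟨w, hw, han⟩ := exists_restr_eq v.2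
  have hwb : ContainsElementary (reversiblePolys R) (annih w) := by rw [han]; exact v.2
  have h1 : w = 0 := eq_zero_of_restr_eq_zero hwb fun n hn => by rw [hw]; exact hd n hn
  exact Subtype.ext (by rw [← hw, h1]; rfl)

end Bijectivity

end RecSeq

end

/-! ### The structure theorem -/

open RecSeq in
theorem mainTheorem1 (R : Type*) [CommRing R] [IsArtinianRing R] (k : ℕ) :
    -- the equalities of the chain
    linRecBi R k = birecBi R k ∧
    (birec R k : Set ((Fin k → ℕ) → R)) = reversibleSeqs R k ∧
    -- the direct sums are bialgebras
    IsBialgebra R (DegenSum (linRecBiRestr R k)) ∧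
    IsBialgebra R (DegenSum (birecBiRestr R k)) ∧
    IsBialgebra R (DegenSum (birecIncl R k)) ∧
    -- degenerating sequences form a subcoalgebra
    (∃ i : degen R k →ₗc[R] linRec R k, ∀ d, i d = d) ∧
    ∃ (β : linRecBi R k →ₐc[R] linRec R k) (γ : linRec R k →ₐ[R] linRecBi R k),
      -- restriction
      (∀ w, β w = linRecBiRestr R k w) ∧
      -- backsolving
      (∀ (u : linRec R k) (w : (Fin k → ℤ) → R),
        IsBacksolution (u : (Fin k → ℕ) → R) w ↔ w = γ u) ∧
      (∀ u, Coalgebra.comul (R := R) (γ u) =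
        TensorProduct.map γ.toLinearMap γ.toLinearMap (Coalgebra.comul (R := R) u)) ∧
      (∀ w, γ (β w) = w) ∧
      RingHom.ker γ = degen R k ∧
      -- the isomorphisms of the chain
      (∃ e : linRec R k ≃ₐc[R] DegenSum (linRecBiRestr R k),
        ∀ u, ((e u).1 : linRec R k) = u - β (γ u) ∧ (e u).2 = γ u) ∧
      (∃ e : linRec R k ≃ₐc[R] DegenSum (birecBiRestr R k),
        ∀ u, ((e u).1 : linRec R k) = u - β (γ u) ∧
          ((e u).2 : (Fin k → ℤ) → R) = (γ u : (Fin k → ℤ) → R)) ∧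
      ∃ e : DegenSum (birecBiRestr R k) ≃ₐc[R] DegenSum (birecIncl R k),
        ∀ x, (e x).1 = x.1 ∧
          ((e x).2 : (Fin k → ℕ) → R) = restr (x.2 : (Fin k → ℤ) → R) := by
  refine ⟨linRecBi_eq_birecBi, birec_eq_reversibleSeqs,
    DegenSum.isBialgebra isCoalgMap_linRecBiRestr toLinRec_linRecBiRestr_bijective,
    DegenSum.isBialgebra isCoalgMap_birecBiRestr toLinRec_birecBiRestr_bijective,
    DegenSum.isBialgebra isCoalgMap_birecIncl toLinRec_birecIncl_bijective,
    ⟨{ toLinearMap := degenIncl R k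
       counit_comp := LinearMap.ext isCoalgMap_degenIncl.counit
       map_comp_comul := LinearMap.ext isCoalgMap_degenIncl.comul }, fun _ => rfl⟩,
    BialgHom.ofAlgHom (linRecBiRestr R k)
      (AlgHom.ext isCoalgMap_linRecBiRestr.counit) (AlgHom.ext isCoalgMap_linRecBiRestr.comul),
    backsolve R k, fun _ => rfl, fun u w => isBacksolution_iff_eq_backsol u w, comul_backsolve,
    backsolve_restr, Ideal.ext fun _ => backsolve_eq_zero_iff, ?_, ?_, ?_⟩
  · refine ⟨(DegenSum.equivLinRec isCoalgMap_linRecBiRestr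
      toLinRec_linRecBiRestr_bijective).symm, fun u => ?_⟩
    rw [DegenSum.equivLinRec_symm_eq _ _ (x := DegenSum.mk (linRecBiRestr R k)
      ⟨_, sub_restr_backsolve_mem_degen u⟩ (backsolve R k u)) (sub_add_cancel _ _)]
    exact ⟨rfl, rfl⟩
  · refine ⟨(DegenSum.equivLinRec isCoalgMap_birecBiRestr
      toLinRec_birecBiRestr_bijective).symm, fun u => ?_⟩
    rw [DegenSum.equivLinRec_symm_eq _ _ (x := DegenSum.mk (birecBiRestr R k)
      ⟨_, sub_restr_backsolve_mem_degen u⟩ ⟨backsol u, backsol_mem u⟩) (sub_add_cancel _ _)]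
    exact ⟨rfl, rfl⟩
  -- The isomorphism passes through `L`: `x` goes to `d + β c` and is decomposed again. The
  -- degenerating part stays, because the bisequence `c` and its restriction in `B` give the same
  -- sequence in `L`, as `h` records.
  · refine ⟨DegenSum.equivDegenSum isCoalgMap_birecBiRestr toLinRec_birecBiRestr_bijective
      isCoalgMap_birecIncl toLinRec_birecIncl_bijective, fun x => ?_⟩
    have h : birecIncl R k (restrict isCharClass_reversible k x.2) = birecBiRestr R k x.2 := rfl
    rw [DegenSum.equivDegenSum_apply _ _ _ _ h]
    exact ⟨rfl, rfl⟩
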